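/- Let $k$ be a field; all algebras and unadorned $\otimes$ are over $k$. A weak Hopf algebra $H$ is a $k$-algebra and $k$-coalgebra $(H,\Delta,\varepsilon)$ such that, in Sweedler notation, $\Delta(hg)=\Delta(h)\Delta(g)$, $$1_1\otimes\Delta(1_2)=1_1\otimes 1_2 1'_1\otimes 1'_2=1_1\otimes 1'_1 1_2\otimes 1'_2,\qquad \varepsilon(hgl)=\varepsilon(hg_1)\varepsilon(g_2l)=\varepsilon(hg_2)\varepsilon(g_1l)$$ for all $h,g,l\in H$ (where $1'$ is another copy of $1$), together with a $k$-linear map $S:H\to H$ satisfying $S*\mathrm{id}_H=\varepsilon_s$, $\mathrm{id}_H*S=\varepsilon_t$ and $S*\mathrm{id}_H*S=S$, where $*$ is the convolution product, $\varepsilon_t(h)=\varepsilon(1_1h)1_2$ and $\varepsilon_s(h)=1_1\varepsilon(h1_2)$. Put $H_t=\varepsilon_t(H)$. Let $H$ be a finite-dimensional weak Hopf algebra over $k$ and let $A$ be a right weak $H$-comodule algebra, that is, a $k$-algebra with a right $H$-comodule structure $\rho:A\to A\otimes H$, $\rho(a)=a_0\otimes a_1$, such that $\rho(ab)=\rho(a)\rho(b)$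 for all $a,b\in A$ and $\rho(1)\in A\otimes H_t$. Let $$B=A^{\mathrm{co}H}=\{a\in A:\ \rho(a)=1_0a\otimes 1_1\},$$ a subalgebra of $A$. Assume that $A/B$ is right weak $H$-Galois, i.e. that the map $$\beta:A\otimes_BA\to A\otimes_tH:=(A\otimes H)\rho(1),\qquad a\otimes_B b\mapsto ab_0\otimes b_1,$$ is bijective, and that $A$ is faithfully flat as a right $B$-module. For a ring $R$ let $\operatorname{fin.dim}R$ be the supremum of the projective dimensions of the finitely generated left $R$-modules of finite projective dimension. If $\operatorname{fin.dim}B<\infty$, then $\operatorname{fin.dim}B\le\operatorname{fin.dim}A$. -/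

import Mathlib

open scoped TensorProduct

universe u v w

noncomputable section

/-! ### Weak bialgebras and weak Hopf algebras -/

section WeakHopf

variable (k : Type u) (H : Type v) [Field k] [Ring H] [Algebra k H] [Coalgebra k H]

/-- A weak bialgebra: an algebra and a coalgebra with multiplicative comultiplication, such that
`Δ²(1) = 1₁ ⊗ 1₂1'₁ ⊗ 1'₂ = 1₁ ⊗ 1'₁1₂ ⊗ 1'₂` and
`ε(hgl) = ε(hg₁)ε(g₂l) = ε(hg₂)ε(g₁l)`. -/
class WeakBialgebra : Prop where
  comul_mul : ∀ h g : H,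
    Coalgebra.comul (R := k) (h * g) = Coalgebra.comul (R := k) h * Coalgebra.comul (R := k) g
  comul_comul_one :
    (Coalgebra.comul (R := k) (A := H)).lTensor H (Coalgebra.comul (R := k) (1 : H)) =
      TensorProduct.assoc k H H H (Coalgebra.comul (R := k) (1 : H) ⊗ₜ[k] (1 : H)) *
        ((1 : H) ⊗ₜ[k] Coalgebra.comul (R := k) (1 : H))
  comul_comul_one' :
    (Coalgebra.comul (R := k) (A := H)).lTensor H (Coalgebra.comul (R := k) (1 : H)) =
      ((1 : H) ⊗ₜ[k] Coalgebra.comul (R := k) (1 : H)) *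
        TensorProduct.assoc k H H H (Coalgebra.comul (R := k) (1 : H) ⊗ₜ[k] (1 : H))
  counit_mul_mul : ∀ h g l : H,
    Coalgebra.counit (R := k) (h * g * l) =
      LinearMap.mul' k k (TensorProduct.map
        (Coalgebra.counit (R := k) ∘ₗ LinearMap.mulLeft k h)
        (Coalgebra.counit (R := k) ∘ₗ LinearMap.mulRight k l) (Coalgebra.comul (R := k) g))
  counit_mul_mul' : ∀ h g l : H,
    Coalgebra.counit (R := k) (h * g * l) =
      LinearMap.mul' k k (TensorProduct.map
        (Coalgebra.counit (R := k) ∘ₗ LinearMap.mulRight k l)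
        (Coalgebra.counit (R := k) ∘ₗ LinearMap.mulLeft k h) (Coalgebra.comul (R := k) g))

/-- The target map `ε_t(h) = ε(1₁h)1₂`. -/
def targetMap : H →ₗ[k] H where
  toFun h := TensorProduct.lid k H
    ((Coalgebra.counit (R := k) ∘ₗ LinearMap.mulRight k h).rTensor H
      (Coalgebra.comul (R := k) (1 : H)))
  map_add' x y := by
    have : LinearMap.mulRight k (x + y) = LinearMap.mulRight k x + LinearMap.mulRight k y := by
      ext; simp [mul_add]
    rw [this, LinearMap.comp_add, LinearMap.rTensor_add, LinearMap.add_apply, map_add]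
  map_smul' c x := by
    have : LinearMap.mulRight k (c • x) = c • LinearMap.mulRight k x := by
      ext; simp
    rw [this, LinearMap.comp_smul, LinearMap.rTensor_smul, LinearMap.smul_apply, map_smul,
      RingHom.id_apply]

/-- The source map `ε_s(h) = 1₁ε(h1₂)`. -/
def sourceMap : H →ₗ[k] H where
  toFun h := TensorProduct.rid k H
    ((Coalgebra.counit (R := k) ∘ₗ LinearMap.mulLeft k h).lTensor H
      (Coalgebra.comul (R := k) (1 : H)))
  map_add' x y := by
    have : LinearMap.mulLeft k (x + y) = LinearMap.mulLeft k x + LinearMap.mulLeft k y := by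
      ext; simp [add_mul]
    rw [this, LinearMap.comp_add, LinearMap.lTensor_add, LinearMap.add_apply, map_add]
  map_smul' c x := by
    have : LinearMap.mulLeft k (c • x) = c • LinearMap.mulLeft k x := by
      ext; simp
    rw [this, LinearMap.comp_smul, LinearMap.lTensor_smul, LinearMap.smul_apply, map_smul,
      RingHom.id_apply]

/-- The target space `H_t`, the image of the target map. -/
def targetSpace : Submodule k H := LinearMap.range (targetMap k H)

variable {k H} in
/-- The convolution product `(f * g)(h) = f(h₁)g(h₂)` of linear endomorphisms of `H`. -/
def convolution (f g : H →ₗ[k] H) : H →ₗ[k] H :=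
  LinearMap.mul' k H ∘ₗ TensorProduct.map f g ∘ₗ Coalgebra.comul

variable {k H} in
/-- `Δ(x) = x1₁ ⊗ 1₂` for `x ∈ H_t`. -/
theorem comul_of_mem_targetSpace [WeakBialgebra k H] {x : H} (hx : x ∈ targetSpace k H) :
    Coalgebra.comul (R := k) x = (x ⊗ₜ[k] (1 : H)) * Coalgebra.comul (R := k) (1 : H) := by
  obtain ⟨h, rfl⟩ := hx
  simp only [targetMap, LinearMap.coe_mk, AddHom.coe_mk]
  generalize Coalgebra.counit (R := k) ∘ₗ LinearMap.mulRight k h = φ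
  have h1 : ∀ z : H ⊗[k] H, Coalgebra.comul (R := k) (TensorProduct.lid k H (φ.rTensor H z)) =
      TensorProduct.lid k (H ⊗[k] H) (φ.rTensor (H ⊗[k] H)
        ((Coalgebra.comul (R := k) (A := H)).lTensor H z)) := by
    intro z
    induction z with
    | zero => simp
    | tmul p q => simp
    | add p q hp hq => simp only [map_add, hp, hq]
  have h2 : ∀ z w : H ⊗[k] H, TensorProduct.lid k (H ⊗[k] H) (φ.rTensor (H ⊗[k] H)
      (TensorProduct.assoc k H H H (z ⊗ₜ[k] (1 : H)) * ((1 : H) ⊗ₜ[k] w))) =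
      (TensorProduct.lid k H (φ.rTensor H z) ⊗ₜ[k] (1 : H)) * w := by
    intro z w
    induction z with
    | zero => simp
    | tmul p q => simp [← TensorProduct.smul_tmul']
    | add p q hp hq => simp only [map_add, TensorProduct.add_tmul, add_mul, hp, hq]
  rw [h1, WeakBialgebra.comul_comul_one, h2]

/-- A weak Hopf algebra: a weak bialgebra with an antipode `S` such that
`S * id = ε_s`, `id * S = ε_t` and `S * id * S = S` for the convolution product. -/
class WeakHopfAlgebra extends WeakBialgebra k H where
  antipode : H →ₗ[k] H
  antipode_conv_id : convolution antipode LinearMap.id = sourceMap k H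
  id_conv_antipode : convolution LinearMap.id antipode = targetMap k H
  antipode_conv_id_conv_antipode :
    convolution (convolution antipode LinearMap.id) antipode = antipode

end WeakHopf

/-! ### Tensor products over a subalgebra -/

section RelTensor

variable {k : Type u} {A : Type w} [Field k] [Ring A] [Algebra k A] (B : Subalgebra k A)

/-- The relations `ab ⊗ m = a ⊗ bm` (`b ∈ B`) in `A ⊗_ℤ M`. The set of generators is stable under
left multiplication by `A`, so its `A`-span is the additive subgroup that it generates. -/
def relTensorRel (M : Type*) [AddCommGroup M] [Module B M] : Submodule A (A ⊗[ℤ] M) :=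
  Submodule.span A {x | ∃ (a : A) (b : B) (m : M),
    x = (a * (b : A)) ⊗ₜ[ℤ] m - a ⊗ₜ[ℤ] (b • m)}

/-- The left `A`-module `A ⊗_B M`, for a left module `M` over a subalgebra `B` of `A`. -/
abbrev RelTensor (M : Type*) [AddCommGroup M] [Module B M] : Type _ :=
  (A ⊗[ℤ] M) ⧸ relTensorRel B M

/-- The map `A ⊗_B f : A ⊗_B M → A ⊗_B N`, `a ⊗ m ↦ a ⊗ f m`. -/
def RelTensor.map {M N : Type*} [AddCommGroup M] [Module B M] [AddCommGroup N] [Module B N]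
    (f : M →ₗ[B] N) : RelTensor B M →ₗ[A] RelTensor B N :=
  Submodule.mapQ (relTensorRel B M) (relTensorRel B N)
    (LinearMap.baseChange A f.toAddMonoidHom.toIntLinearMap) (by
      refine Submodule.span_le.2 ?_
      rintro _ ⟨a, b, m, rfl⟩
      refine Submodule.subset_span ⟨a, b, f m, ?_⟩
      simp)

/-- `A` is faithfully flat as a right `B`-module: a sequence `M → N → P` of left `B`-modules is
exact if and only if `A ⊗_B M → A ⊗_B N → A ⊗_B P` is exact. -/
def IsRightFaithfullyFlat : Prop :=
  ∀ (M N P : Type w) [AddCommGroup M] [AddCommGroup N] [AddCommGroup P]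
    [Module B M] [Module B N] [Module B P] (f : M →ₗ[B] N) (g : N →ₗ[B] P),
    Function.Exact f g ↔ Function.Exact (RelTensor.map B f) (RelTensor.map B g)

end RelTensor

/-! ### Weak comodule algebras and weak Galois extensions -/

section Galois

variable (k : Type u) (H : Type v) (A : Type w) [Field k] [Ring H] [Algebra k H] [Coalgebra k H]
  [Ring A] [Algebra k A]

/-- A right weak `H`-comodule algebra structure on the algebra `A`: a right `H`-comodule structure
`ρ : A → A ⊗ H` that is multiplicative and satisfies `ρ(1) ∈ A ⊗ H_t`. -/
structure WeakComoduleAlgebra where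
  coact : A →ₗ[k] A ⊗[k] H
  coassoc : ∀ a : A, TensorProduct.assoc k A H H (coact.rTensor H (coact a)) =
    (Coalgebra.comul (R := k) (A := H)).lTensor A (coact a)
  counit_coact : ∀ a : A, TensorProduct.rid k A
    ((Coalgebra.counit (R := k) (A := H)).lTensor A (coact a)) = a
  coact_mul : ∀ a b : A, coact (a * b) = coact a * coact b
  coact_one_mem : coact 1 ∈ LinearMap.range ((targetSpace k H).subtype.lTensor A)

namespace WeakComoduleAlgebra

variable {k H A} (ρ : WeakComoduleAlgebra k H A)

/-- The subalgebra of coinvariants `A^{co H} = {a | ρ(a) = 1₀a ⊗ 1₁}`. -/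
def coinvariants : Subalgebra k A where
  carrier := {a | ρ.coact a = ρ.coact 1 * (a ⊗ₜ[k] 1)}
  mul_mem' {a b} ha hb := by
    simp only [Set.mem_ofPred_eq] at ha hb ⊢
    have h1 : ρ.coact a * ρ.coact 1 = ρ.coact a := by rw [← ρ.coact_mul, mul_one]
    rw [ρ.coact_mul, hb, ← mul_assoc, h1, ha, mul_assoc]
    simp
  add_mem' {a b} ha hb := by
    simp only [Set.mem_ofPred_eq] at ha hb ⊢
    rw [map_add, ha, hb, ← mul_add, TensorProduct.add_tmul]
  algebraMap_mem' c := by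
    simp only [Set.mem_ofPred_eq]
    rw [Algebra.algebraMap_eq_smul_one, map_smul, ← TensorProduct.smul_tmul',
      mul_smul_comm, ← Algebra.TensorProduct.one_def, mul_one]

/-- `A ⊗_t H = (A ⊗ H)ρ(1)`, as a left `A`-submodule of `A ⊗ H`. -/
def targetTensor : Submodule A (A ⊗[k] H) where
  carrier := {x | ∃ y : A ⊗[k] H, x = y * ρ.coact 1}
  add_mem' := by
    rintro _ _ ⟨x, rfl⟩ ⟨y, rfl⟩
    exact ⟨x + y, (add_mul _ _ _).symm⟩
  zero_mem' := ⟨0, (zero_mul _).symm⟩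
  smul_mem' := by
    rintro a _ ⟨x, rfl⟩
    exact ⟨a • x, (smul_mul_assoc _ _ _).symm⟩

/-- `ε(x1₁)1₂ = x` for `x ∈ H_t`. -/
theorem counit_mul_of_mem_targetSpace [WeakBialgebra k H] {x : H} (hx : x ∈ targetSpace k H) :
    TensorProduct.lid k H ((Coalgebra.counit (R := k) (A := H)).rTensor H
      ((x ⊗ₜ[k] (1 : H)) * Coalgebra.comul (R := k) (1 : H))) = x := by
  rw [← comul_of_mem_targetSpace hx, Coalgebra.rTensor_counit_comul]
  simp

/-- Coinvariants also satisfy `ρ(b) = b1₀ ⊗ 1₁`. -/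
theorem coact_of_mem_coinvariants [WeakBialgebra k H] {b : A} (hb : b ∈ ρ.coinvariants) :
    ρ.coact b = b • ρ.coact 1 := by
  replace hb : ρ.coact b = ρ.coact 1 * (b ⊗ₜ[k] 1) := hb
  -- `Φ (a ⊗ h) = a ⊗ ε(h1₁)1₂`
  let E : (A ⊗[k] H) ⊗[k] H →ₗ[k] A ⊗[k] H :=
    ((TensorProduct.rid k A).toLinearMap ∘ₗ
      (Coalgebra.counit (R := k) (A := H)).lTensor A).rTensor H
  let Φ : A ⊗[k] H → A ⊗[k] H := fun z =>
    E ((z ⊗ₜ[k] (1 : H)) * (TensorProduct.assoc k A H H).symm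
      ((1 : A) ⊗ₜ[k] Coalgebra.comul (R := k) (1 : H)))
  have Φadd : ∀ x y, Φ (x + y) = Φ x + Φ y := fun x y => by
    simp only [Φ, TensorProduct.add_tmul, add_mul, map_add]
  have Φzero : Φ 0 = 0 := by simp [Φ]
  have Etmul : ∀ (a : A) (h : H) (w : H ⊗[k] H),
      E (((a ⊗ₜ[k] h) ⊗ₜ[k] (1 : H)) * (TensorProduct.assoc k A H H).symm ((1 : A) ⊗ₜ[k] w)) =
      a ⊗ₜ[k] TensorProduct.lid k H ((Coalgebra.counit (R := k) (A := H)).rTensor H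
        ((h ⊗ₜ[k] (1 : H)) * w)) := by
    intro a h w
    induction w with
    | zero => simp
    | tmul p q => simp [E, TensorProduct.smul_tmul]
    | add p q hp hq => simp only [map_add, TensorProduct.tmul_add, mul_add, hp, hq]
  obtain ⟨t, ht⟩ := ρ.coact_one_mem
  have hfix : Φ (ρ.coact b) = ρ.coact b := by
    rw [hb, ← ht]
    clear ht
    induction t with
    | zero => simp [Φzero]
    | tmul u x =>
      simp only [LinearMap.lTensor_tmul, Submodule.subtype_apply,
        Algebra.TensorProduct.tmul_mul_tmul, mul_one]
      simp only [Φ]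
      rw [Etmul, counit_mul_of_mem_targetSpace x.2]
    | add p q hp hq => simp only [map_add, add_mul, Φadd, hp, hq]
  have hone : ρ.coact.rTensor H (ρ.coact 1) = (ρ.coact 1 ⊗ₜ[k] (1 : H)) *
      (TensorProduct.assoc k A H H).symm
        ((1 : A) ⊗ₜ[k] Coalgebra.comul (R := k) (1 : H)) := by
    rw [← LinearEquiv.symm_apply_apply (TensorProduct.assoc k A H H)
      (ρ.coact.rTensor H (ρ.coact 1)), ρ.coassoc, ← ht]
    clear hfix ht
    have aux : ∀ (a : A) (h : H) (w : H ⊗[k] H),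
        (TensorProduct.assoc k A H H).symm (a ⊗ₜ[k] ((h ⊗ₜ[k] (1 : H)) * w)) =
        ((a ⊗ₜ[k] h) ⊗ₜ[k] (1 : H)) *
          (TensorProduct.assoc k A H H).symm ((1 : A) ⊗ₜ[k] w) := by
      intro a h w
      induction w with
      | zero => simp
      | tmul p q => simp
      | add p q hp hq => simp only [map_add, TensorProduct.tmul_add, mul_add, hp, hq]
    induction t with
    | zero => simp
    | tmul u x =>
      simp only [LinearMap.lTensor_tmul, Submodule.subtype_apply]
      rw [comul_of_mem_targetSpace x.2, aux]
    | add p q hp hq => simp only [map_add, TensorProduct.add_tmul, add_mul, hp, hq]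
  have hmul : ∀ z : A ⊗[k] H, ρ.coact.rTensor H (b • z) =
      (ρ.coact b ⊗ₜ[k] (1 : H)) * ρ.coact.rTensor H z := by
    intro z
    induction z with
    | zero => simp
    | tmul p q => simp [TensorProduct.smul_tmul', ρ.coact_mul]
    | add p q hp hq => simp only [smul_add, map_add, mul_add, hp, hq]
  have hE : ∀ z : A ⊗[k] H, E (ρ.coact.rTensor H z) = z := by
    intro z
    induction z with
    | zero => simp
    | tmul p q => simp [E, ρ.counit_coact]
    | add p q hp hq => simp only [map_add, hp, hq]
  rw [← hfix, ← hE (b • ρ.coact 1), hmul, hone, ← mul_assoc,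
    Algebra.TensorProduct.tmul_mul_tmul, ← ρ.coact_mul, mul_one, mul_one]

/-- The map `A ⊗_ℤ A → A ⊗ H`, `a ⊗ b ↦ ab₀ ⊗ b₁`. -/
def preGalois : A ⊗[ℤ] A →ₗ[A] A ⊗[k] H :=
  TensorProduct.AlgebraTensorModule.lift
    (LinearMap.toSpanSingleton A (A →ₗ[ℤ] A ⊗[k] H) ρ.coact.toAddMonoidHom.toIntLinearMap)

theorem preGalois_tmul (a b : A) : ρ.preGalois (a ⊗ₜ[ℤ] b) = a • ρ.coact b := rfl

theorem preGalois_mem (x : A ⊗[ℤ] A) : ρ.preGalois x ∈ ρ.targetTensor := by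
  induction x with
  | zero => simp
  | tmul a b =>
    refine ⟨a • ρ.coact b, ?_⟩
    rw [preGalois_tmul, smul_mul_assoc, ← ρ.coact_mul, mul_one]
  | add x y hx hy => rw [map_add]; exact add_mem hx hy

/-- The canonical map `β : A ⊗_B A → A ⊗_t H`, `a ⊗ b ↦ ab₀ ⊗_t b₁`, where `B = A^{co H}`. -/
def galoisMap [WeakBialgebra k H] :
    RelTensor ρ.coinvariants A →ₗ[A] ρ.targetTensor :=
  Submodule.liftQ (relTensorRel ρ.coinvariants A)
    (LinearMap.codRestrict ρ.targetTensor ρ.preGalois ρ.preGalois_mem) (by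
      refine Submodule.span_le.2 ?_
      rintro _ ⟨a, b, c, rfl⟩
      refine Subtype.ext ?_
      have hb : ρ.coact ((b : A) * c) = (b : A) • ρ.coact c := by
        rw [ρ.coact_mul, ρ.coact_of_mem_coinvariants b.2, smul_mul_assoc, ← ρ.coact_mul, one_mul]
      simp [preGalois_tmul, Subalgebra.smul_def, hb, mul_smul])

/-- The value of `β` on `a ⊗ b` is `(a ⊗ 1)ρ(b)`. -/
theorem galoisMap_mk_tmul [WeakBialgebra k H] (a b : A) :
    (ρ.galoisMap (Submodule.Quotient.mk (a ⊗ₜ[ℤ] b)) : A ⊗[k] H) =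
      (a ⊗ₜ[k] 1) * ρ.coact b := by
  change a • ρ.coact b = _
  generalize ρ.coact b = z
  induction z with
  | zero => simp
  | tmul p q => simp [TensorProduct.smul_tmul']
  | add p q hp hq => simp only [smul_add, mul_add, hp, hq]

/-- `A / A^{co H}` is a right weak `H`-Galois extension: `β` is bijective. -/
def IsWeakGalois [WeakBialgebra k H] : Prop := Function.Bijective ρ.galoisMap

end WeakComoduleAlgebra

end Galois

/-! ### Finitistic dimension -/

/-- The finitistic dimension of `R`: the supremum of the projective dimensions of the finitely
generated left `R`-modules of finite projective dimension. (The zero module has projective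
dimension `⊥`, and `⊤` stands for `∞`.) -/
def finitisticDimension (R : Type w) [Ring R] : WithBot ℕ∞ :=
  sSup {d | ∃ M : ModuleCat.{w} R, Module.Finite R M ∧
    CategoryTheory.projectiveDimension M < ⊤ ∧ d = CategoryTheory.projectiveDimension M}

end

noncomputable section

/-! ### Projective dimension and exact sequences of modules -/

section ProjectiveDimension

open CategoryTheory

variable {R : Type w} [Ring R] {X Y Z : Type w} [AddCommGroup X] [AddCommGroup Y] [AddCommGroup Z]
  [Module R X] [Module R Y] [Module R Z]

/-! Write `B` for the coinvariants. The argument has a homological half and a Hopf-theoretic half,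
which meet in one fact: `A` is finitely generated projective as a left `B`-module.

Homological half (`finitisticDimension_le_of_faithfullyFlat`). Projective dimensions take discrete
values, so a finite `fin.dim B = n` is attained by some finitely generated `M`. Flatness gives `pd_A
(A ⊗_B M) ≤ n`, so it suffices to exclude `pd_A (A ⊗_B M) < n`. In that case `pd_B (A ⊗_B M) < n`,
because `A` is projective over `B`. Faithful flatness makes `M → A ⊗_B M` injective, and its
cokernel `C` is finitely generated of finite projective dimension, so `pd_B C ≤ n` by definition of
`n`. The exact sequence `0 → M → A ⊗_B M → C → 0` then forces `pd M < n`, a contradiction.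

Hopf-theoretic half (`IsWeakGalois.projective_and_finite`). A functional `T` on `H` with `x₁T(x₂)`
fixed by `ε_t` gives a left `B`-linear map `a ↦ a₀T(a₁)` from `A` to `B`. Such integrals are
produced as traces: for each `φ` in the dual of `H`, `T_φ(x)` is the trace of `w ↦
(xS²(w))₁φ((xS²(w))₂)`. If `bᵢ` is a basis of `H` with dual basis `bⁱ` and `Tᵢ = T_{bⁱ}`, cyclicity
of the trace gives `∑ Tᵢ(xS(bᵢ)) = ε(x)`. Lifting `(1 ⊗ bᵢ)ρ(1)` along `β` to `∑ⱼ xᵢⱼ ⊗ yᵢⱼ`, one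
gets `∑ⱼ (axᵢⱼ)₀Tᵢ((axᵢⱼ)₁)yᵢⱼ = a₀Tᵢ(a₁S(bᵢ))`, and the sum over `i` is `a`. This is a finite dual
basis of `A` over `B`.

The trace computations need `S` to reverse products and coproducts; both follow from uniqueness of
relative inverses in convolution algebras. -/

theorem shortExact_of_exact {f : X →ₗ[R] Y} {g : Y →ₗ[R] Z} (hf : Function.Injective f)
    (hg : Function.Surjective g) (hfg : Function.Exact f g) :
    (ModuleCat.shortComplexOfCompEqZero f g hfg.linearMap_comp_eq_zero).ShortExact where
  exact := (ShortComplex.ShortExact.moduleCat_exact_iff_function_exact _).mpr hfg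
  mono_f := (ModuleCat.mono_iff_injective _).mpr hf
  epi_g := (ModuleCat.epi_iff_surjective _).mpr hg

theorem hasProjectiveDimensionLE_zero_iff :
    HasProjectiveDimensionLE (ModuleCat.of R X) 0 ↔ Module.Projective R X := by
  rw [← projective_iff_hasProjectiveDimensionLE_zero]
  exact (IsProjective.iff_projective X).symm

theorem hasProjectiveDimensionLE_succ_iff_of_exact [Module.Projective R Y] {f : X →ₗ[R] Y}
    {g : Y →ₗ[R] Z} (hf : Function.Injective f) (hg : Function.Surjective g)
    (hfg : Function.Exact f g) (n : ℕ) :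
    HasProjectiveDimensionLE (ModuleCat.of R Z) (n + 1) ↔
      HasProjectiveDimensionLE (ModuleCat.of R X) n :=
  (shortExact_of_exact hf hg hfg).hasProjectiveDimensionLT_X₃_iff n
    ((IsProjective.iff_projective Y).mp ‹_›)

variable (R X) in
-- The free module on the underlying set of `X` does not leave the universe `w`, so kernels can be
-- resolved again in inductions on the dimension.
theorem exists_projective_presentation : ∃ (K P : Type w) (_ : AddCommGroup K)
    (_ : AddCommGroup P) (_ : Module R K) (_ : Module R P) (_ : Module.Projective R P)
    (f : K →ₗ[R] P) (g : P →ₗ[R] X),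
    Function.Injective f ∧ Function.Surjective g ∧ Function.Exact f g := by
  have hs : Function.Surjective (Finsupp.linearCombination R (id : X → X)) :=
    Finsupp.linearCombination_id_surjective R X
  exact ⟨LinearMap.ker (Finsupp.linearCombination R (id : X → X)), X →₀ R, inferInstance,
    inferInstance, inferInstance, inferInstance, inferInstance, Submodule.subtype _, _,
    Submodule.injective_subtype _, hs, LinearMap.exact_subtype_ker_map _⟩

end ProjectiveDimension

/-! ### Induction along a subalgebra -/

section RelTensor

variable {k : Type u} {A : Type w} [Field k] [Ring A] [Algebra k A] {B : Subalgebra k A}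

namespace RelTensor

section

variable {M : Type*} [AddCommGroup M] [Module B M] {Y : Type*} [AddCommGroup Y] [Module A Y]

theorem mk_mul_tmul (a : A) (b : B) (m : M) :
    (Submodule.Quotient.mk ((a * (b : A)) ⊗ₜ[ℤ] m) : RelTensor B M) =
      Submodule.Quotient.mk (a ⊗ₜ[ℤ] (b • m)) :=
  (Submodule.Quotient.eq _).2 (Submodule.subset_span ⟨a, b, m, rfl⟩)

variable (B M) in
/-- The canonical map `M → A ⊗_B M`, `m ↦ 1 ⊗ m`. -/
def unit : M →ₗ[B] RelTensor B M where
  toFun m := Submodule.Quotient.mk ((1 : A) ⊗ₜ[ℤ] m)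
  map_add' x y := by rw [TensorProduct.tmul_add, Submodule.Quotient.mk_add]
  map_smul' b m := by
    rw [← mk_mul_tmul, one_mul, RingHom.id_apply, Subalgebra.smul_def,
      ← Submodule.Quotient.mk_smul, TensorProduct.smul_tmul', smul_eq_mul, mul_one]

theorem mk_tmul (a : A) (m : M) :
    (Submodule.Quotient.mk (a ⊗ₜ[ℤ] m) : RelTensor B M) = a • unit B M m := by
  change _ = a • Submodule.Quotient.mk _
  rw [← Submodule.Quotient.mk_smul, TensorProduct.smul_tmul', smul_eq_mul, mul_one]

theorem induction_on {p : RelTensor B M → Prop} (x : RelTensor B M) (zero : p 0)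
    (smul_unit : ∀ (a : A) m, p (a • unit B M m)) (hadd : ∀ x y, p x → p y → p (x + y)) : p x := by
  obtain ⟨t, rfl⟩ := Submodule.Quotient.mk_surjective _ x
  induction t with
  | zero => exact zero
  | tmul a m => rw [mk_tmul]; exact smul_unit a m
  | add x y hx hy => rw [Submodule.Quotient.mk_add]; exact hadd _ _ hx hy

theorem hom_ext {f g : RelTensor B M →ₗ[A] Y} (h : ∀ m, f (unit B M m) = g (unit B M m)) :
    f = g := by
  refine LinearMap.ext fun x => ?_
  induction x using induction_on with
  | zero => simp
  | smul_unit a m => rw [map_smul, map_smul, h]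
  | hadd x y hx hy => rw [map_add, map_add, hx, hy]

/-- The `A`-linear extension of a `B`-linear map `M → Y` to `A ⊗_B M`. -/
def lift (f : M →ₗ[B] Y) : RelTensor B M →ₗ[A] Y :=
  Submodule.liftQ (relTensorRel B M)
    (TensorProduct.AlgebraTensorModule.lift
      (LinearMap.toSpanSingleton A (M →ₗ[ℤ] Y) f.toAddMonoidHom.toIntLinearMap)) (by
    refine Submodule.span_le.2 ?_
    rintro _ ⟨a, b, m, rfl⟩
    simp [mul_smul, Subalgebra.smul_def])

@[simp]
theorem lift_unit (f : M →ₗ[B] Y) (m : M) : lift f (unit B M m) = f m := by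
  change (1 : A) • f m = f m
  rw [one_smul]

@[simp]
theorem map_unit {N : Type*} [AddCommGroup N] [Module B N] (f : M →ₗ[B] N) (m : M) :
    RelTensor.map B f (unit B M m) = unit B N (f m) := rfl

instance finite [Module.Finite B M] : Module.Finite A (RelTensor B M) := by
  obtain ⟨s, hs⟩ := Module.Finite.fg_top (R := B) (M := M)
  classical
  refine ⟨⟨s.image (unit B M), eq_top_iff.2 fun x _ => ?_⟩⟩
  have hunit : ∀ m : M, unit B M m ∈
      Submodule.span A (s.image (unit B M) : Set (RelTensor B M)) := by
    intro m
    have hm : m ∈ Submodule.span B (s : Set M) := hs ▸ Submodule.mem_top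
    induction hm using Submodule.span_induction with
    | mem x hx => exact Submodule.subset_span (by simpa using ⟨x, hx, rfl⟩)
    | zero => simp
    | add x y _ _ hx hy => rw [map_add]; exact add_mem hx hy
    | smul b x _ hx => rw [map_smul]; exact Submodule.smul_mem _ (b : A) hx
  induction x using induction_on with
  | zero => exact zero_mem _
  | smul_unit a m => exact Submodule.smul_mem _ _ (hunit m)
  | hadd x y hx hy => exact add_mem (hx trivial) (hy trivial)

end

/-- Induction is left adjoint to restriction, which preserves surjections: lift over `B` and extend
the lift `A`-linearly. -/
instance projective {P : Type w} [AddCommGroup P] [Module B P] [Module.Projective B P] :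
    Module.Projective A (RelTensor B P) := by
  refine Module.Projective.of_lifting_property fun {X Y} _ _ _ _ f g hf => ?_
  obtain ⟨h, hh⟩ := Module.projective_lifting_property (f.restrictScalars B)
    (g.restrictScalars B ∘ₗ unit B P) hf
  refine ⟨lift h, hom_ext fun m => ?_⟩
  simpa using LinearMap.congr_fun hh m

end RelTensor

namespace IsRightFaithfullyFlat

variable (hflat : IsRightFaithfullyFlat B)
  {M N : Type w} [AddCommGroup M] [Module B M] [AddCommGroup N] [Module B N]
include hflat

/-- Injectivity is exactness of `0 → M → N`, so the exactness criterion applies with zero module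
`PUnit`. -/
theorem injective_map_iff (f : M →ₗ[B] N) :
    Function.Injective (RelTensor.map B f) ↔ Function.Injective f := by
  have hz : RelTensor.map B (0 : PUnit.{w + 1} →ₗ[B] M) = 0 := RelTensor.hom_ext fun m => by simp
  have h := hflat PUnit.{w + 1} M N (0 : PUnit.{w + 1} →ₗ[B] M) f
  rw [hz, LinearMap.exact_zero_iff_injective, LinearMap.exact_zero_iff_injective] at h
  exact h.symm

theorem surjective_map {f : M →ₗ[B] N} (hf : Function.Surjective f) :
    Function.Surjective (RelTensor.map B f) := by
  have hz : RelTensor.map B (0 : N →ₗ[B] PUnit.{w + 1}) = 0 := RelTensor.hom_ext fun m => by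
    rw [RelTensor.map_unit, LinearMap.zero_apply, map_zero, LinearMap.zero_apply]
  have h := hflat M N PUnit.{w + 1} f (0 : N →ₗ[B] PUnit.{w + 1})
  rw [hz, LinearMap.exact_zero_iff_surjective, LinearMap.exact_zero_iff_surjective] at h
  exact h.1 hf

variable (M) in
-- After inducing, the unit is split by `a ⊗ x ↦ ax`, hence injective; faithful flatness reflects
-- this back.
theorem injective_unit : Function.Injective (RelTensor.unit B M) := by
  rw [← hflat.injective_map_iff]
  have h : RelTensor.lift (LinearMap.id : RelTensor B M →ₗ[B] RelTensor B M) ∘ₗ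
      RelTensor.map B (RelTensor.unit B M) = LinearMap.id := RelTensor.hom_ext fun m => by simp
  exact Function.LeftInverse.injective (g := RelTensor.lift LinearMap.id) fun x =>
    LinearMap.congr_fun h x

end IsRightFaithfullyFlat

/-! ### Projective dimension under induction and restriction -/

open CategoryTheory

/-- Dimension shifting: induction keeps projectives projective, and flatness keeps the presentation
exact. -/
theorem IsRightFaithfullyFlat.hasProjectiveDimensionLE_relTensor (hflat : IsRightFaithfullyFlat B)
    {M : Type w} [AddCommGroup M] [Module B M] {n : ℕ}
    (hM : HasProjectiveDimensionLE (ModuleCat.of B M) n) :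
    HasProjectiveDimensionLE (ModuleCat.of A (RelTensor B M)) n := by
  induction n generalizing M with
  | zero =>
    rw [hasProjectiveDimensionLE_zero_iff] at hM ⊢
    infer_instance
  | succ n ih =>
    obtain ⟨K, P, _, _, _, _, _, f, g, hf, hg, hfg⟩ := exists_projective_presentation B M
    rw [hasProjectiveDimensionLE_succ_iff_of_exact hf hg hfg] at hM
    rw [hasProjectiveDimensionLE_succ_iff_of_exact ((hflat.injective_map_iff f).2 hf)
      (hflat.surjective_map hg) ((hflat K P M f g).1 hfg)]
    exact ih hM

/-- `Y` is a direct summand of a direct sum of copies of `A`, which is projective over `B`. -/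
theorem projective_of_projective_subalgebra [Module.Projective B A] {Y : Type*} [AddCommGroup Y]
    [Module A Y] [Module.Projective A Y] : Module.Projective B Y := by
  obtain ⟨s, hs⟩ := (Module.projective_def' (R := A) (P := Y)).1 ‹_›
  have : Module.Projective B (Y →₀ A) := by
    classical
    exact Module.Projective.of_equiv (finsuppLequivDFinsupp B).symm
  exact Module.Projective.of_split (s.restrictScalars B)
    ((Finsupp.linearCombination A (id : Y → Y)).restrictScalars B)
    (LinearMap.ext fun y => LinearMap.congr_fun hs y)

/-- The strict form includes the bound `0`, which says that the module vanishes; the main argument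
needs it when the finitistic dimension is `0`. -/
theorem hasProjectiveDimensionLT_restrict [Module.Projective B A] {Y : Type w} [AddCommGroup Y]
    [Module A Y] {n : ℕ} (hY : HasProjectiveDimensionLT (ModuleCat.of A Y) n) :
    HasProjectiveDimensionLT (ModuleCat.of B Y) n := by
  obtain _ | n := n
  · rw [hasProjectiveDimensionLT_zero_iff_isZero, ModuleCat.isZero_iff_subsingleton] at hY ⊢
    exact hY
  change HasProjectiveDimensionLE _ n at hY ⊢
  induction n generalizing Y with
  | zero =>
    rw [hasProjectiveDimensionLE_zero_iff] at hY ⊢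
    exact projective_of_projective_subalgebra
  | succ n ih =>
    obtain ⟨K, P, _, _, _, _, _, f, g, hf, hg, hfg⟩ := exists_projective_presentation A Y
    rw [hasProjectiveDimensionLE_succ_iff_of_exact hf hg hfg] at hY
    have : Module.Projective B P := projective_of_projective_subalgebra (A := A)
    rw [hasProjectiveDimensionLE_succ_iff_of_exact (f := f.restrictScalars B)
      (g := g.restrictScalars B) hf hg hfg]
    exact ih hY

end RelTensor

/-! ### Finitistic dimensions of faithfully flat extensions -/

section FinitisticDimension

open CategoryTheory

/-- A finite supremum in `WithBot ℕ∞` is `⊥` or a natural number, hence has a predecessor or is the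
bottom element. If it were not attained, all values would lie at or below the predecessor. -/
theorem exists_projectiveDimension_eq_finitisticDimension {R : Type w} [Ring R]
    (h : finitisticDimension R < ⊤) : ∃ M : ModuleCat.{w} R, Module.Finite R M ∧
      projectiveDimension M = finitisticDimension R := by
  by_contra! hne
  have hlt : ∀ d ∈ {d | ∃ M : ModuleCat.{w} R, Module.Finite R M ∧
      projectiveDimension M < ⊤ ∧ d = projectiveDimension M}, d < finitisticDimension R := by
    rintro _ ⟨M, hM, hM', rfl⟩
    exact lt_of_le_of_ne (le_sSup ⟨M, hM, hM', rfl⟩) (hne M hM)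
  have key : ∀ e < finitisticDimension R, ∃ M : ModuleCat.{w} R, Module.Finite R M ∧
      projectiveDimension M < ⊤ ∧ e < projectiveDimension M := by
    intro e he
    obtain ⟨_, ⟨M, hM, hM', rfl⟩, hlt'⟩ := lt_sSup_iff.1 he
    exact ⟨M, hM, hM', hlt'⟩
  have hbot : projectiveDimension (ModuleCat.of R PUnit.{w + 1}) = ⊥ := by
    rw [projectiveDimension_eq_bot_iff, ModuleCat.isZero_iff_subsingleton]
    infer_instance
  -- The zero module contributes the value `⊥`; it excludes a supremum equal to `⊥`.
  have hzero := hlt _ ⟨ModuleCat.of R PUnit.{w + 1}, inferInstance, by simp [hbot], rfl⟩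
  obtain ⟨d, hd⟩ : ∃ d, finitisticDimension R = d := ⟨_, rfl⟩
  rw [hd] at h hlt key hzero
  induction d with
  | bot => exact not_lt_bot hzero
  | coe d =>
  induction d with
  | top => exact lt_irrefl _ h
  | coe n =>
  obtain _ | n := n
  -- The predecessor of `0` is `⊥`: some module has dimension above `⊥` yet below `0`.
  · obtain ⟨M, hM, hM', hMd⟩ := key ⊥ (WithBot.bot_lt_coe _)
    have h0 := hlt _ ⟨M, hM, hM', rfl⟩
    have h1 : projectiveDimension M < ((0 : ℕ) : WithBot ℕ∞) := h0
    rw [projectiveDimension_lt_iff, hasProjectiveDimensionLT_zero_iff_isZero,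
      ← projectiveDimension_eq_bot_iff] at h1
    exact hMd.ne' h1
  · have hn : ((n : ℕ) : WithBot ℕ∞) < ((n + 1 : ℕ) : WithBot ℕ∞) := by
      exact_mod_cast n.lt_succ_self
    obtain ⟨M, hM, hM', hMd⟩ := key n hn
    have h0 := hlt _ ⟨M, hM, hM', rfl⟩
    have h1 : projectiveDimension M < ((n + 1 : ℕ) : WithBot ℕ∞) := h0
    rw [Nat.cast_add, Nat.cast_one, ENat.WithBot.lt_add_one_iff] at h1
    exact absurd hMd (not_lt.2 h1)

theorem projectiveDimension_le_finitisticDimension {R : Type w} [Ring R] (M : ModuleCat.{w} R)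
    [Module.Finite R M] (h : projectiveDimension M < ⊤) :
    projectiveDimension M ≤ finitisticDimension R :=
  le_sSup ⟨M, ‹_›, h, rfl⟩

variable {k : Type u} {A : Type w} [Field k] [Ring A] [Algebra k A] {B : Subalgebra k A}

/-- If `A` is faithfully flat as a right `B`-module and finitely generated projective as a left
`B`-module, and `B` has finite finitistic dimension, then the finitistic dimension of `B` is at
most that of `A`. -/
theorem finitisticDimension_le_of_faithfullyFlat [Module.Finite B A] [Module.Projective B A]
    (hflat : IsRightFaithfullyFlat B) (hfin : finitisticDimension B < ⊤) :
    finitisticDimension B ≤ finitisticDimension A := by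
  obtain ⟨M, _, hM⟩ := exists_projectiveDimension_eq_finitisticDimension hfin
  obtain ⟨d, hd⟩ : ∃ d, finitisticDimension B = d := ⟨_, rfl⟩
  rw [hd] at hfin hM ⊢
  induction d with
  | bot => exact bot_le
  | coe d =>
  induction d with
  | top => exact absurd hfin (lt_irrefl _)
  | coe n =>
  have hMn : HasProjectiveDimensionLE M n := (projectiveDimension_le_iff M n).1 hM.le
  have hAM := hflat.hasProjectiveDimensionLE_relTensor hMn
  have hlt : projectiveDimension (ModuleCat.of A (RelTensor B M)) < ⊤ :=
    (lt_top_iff_ne_top.2 ((projectiveDimension_ne_top_iff _).2 ⟨n, hAM⟩))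
  refine le_trans ?_ (projectiveDimension_le_finitisticDimension _ hlt)
  -- Suppose the induced module has dimension less than `n` over `A`.
  refine (projectiveDimension_ge_iff _ n).2 fun hcontra => ?_
  have hres : HasProjectiveDimensionLT (ModuleCat.of B (RelTensor B M)) n :=
    hasProjectiveDimensionLT_restrict hcontra
  have : Module.Finite B (RelTensor B M) := Module.Finite.trans A _
  let C := RelTensor B M ⧸ LinearMap.range (RelTensor.unit B M)
  have hS := shortExact_of_exact (f := RelTensor.unit B M)
    (g := (LinearMap.range (RelTensor.unit B M)).mkQ) (hflat.injective_unit M)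
    (Submodule.mkQ_surjective _) (LinearMap.exact_map_mkQ_range _)
  -- This crude bound only shows that the dimension of `C` is finite; the definition of `n` as
  -- finitistic dimension then improves it to `≤ n`.
  have hC : HasProjectiveDimensionLT (ModuleCat.of B C) (n + 2) :=
    hS.hasProjectiveDimensionLT_X₃ (n + 1) hMn (hasProjectiveDimensionLT_of_ge _ n _ (by lia))
  have hC' : HasProjectiveDimensionLT (ModuleCat.of B C) (n + 1) := by
    refine (projectiveDimension_le_iff (ModuleCat.of B C) n).1 ?_
    refine (projectiveDimension_le_finitisticDimension (ModuleCat.of B C) ?_).trans hd.le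
    exact lt_top_iff_ne_top.2 ((projectiveDimension_ne_top_iff _).2 ⟨n + 1, hC⟩)
  exact (projectiveDimension_ge_iff M n).1 hM.ge (hS.hasProjectiveDimensionLT_X₁ n hres hC')

end FinitisticDimension

/-! ### Weak bialgebras -/

section WeakBialgebra

open Coalgebra

variable {k : Type u} {H : Type v} [Field k] [Ring H] [Algebra k H] [Coalgebra k H]

local notation "Δ" => Coalgebra.comul (R := k) (A := H)
local notation "ε" => Coalgebra.counit (R := k) (A := H)

theorem targetMap_apply_eq_sum {ι : Type*} (r : Coalgebra.Repr k (1 : H) ι) (h : H) :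
    targetMap k H h = ∑ i ∈ r.index, ε (r.left i * h) • r.right i := by
  simp [targetMap, ← r.eq]

theorem sourceMap_apply_eq_sum {ι : Type*} (r : Coalgebra.Repr k (1 : H) ι) (h : H) :
    sourceMap k H h = ∑ i ∈ r.index, ε (h * r.right i) • r.left i := by
  simp [sourceMap, ← r.eq]

theorem targetMap_one : targetMap k H 1 = 1 := by
  simp [targetMap]

theorem sourceMap_one : sourceMap k H 1 = 1 := by
  simp [sourceMap]

/-- `a₀ ⊗ ε_t(a₁) = 1₀a ⊗ 1₁` for a multiplicative counital map `ρ : A → A ⊗ H` with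
`ρ(1₀) ⊗ 1₁ = 1₀ ⊗ 1'₁1₁ ⊗ 1'₂`. -/
theorem lTensor_targetMap_of_multiplicative {A : Type w} [Ring A] [Algebra k A]
    (ρ : A →ₗ[k] A ⊗[k] H) (hmul : ∀ a b, ρ (a * b) = ρ a * ρ b)
    (hcounit : ∀ a, TensorProduct.rid k A ((ε).lTensor A (ρ a)) = a)
    (hone : ρ.rTensor H (ρ 1) = (TensorProduct.assoc k A H H).symm ((1 : A) ⊗ₜ[k] Δ 1) *
      (ρ 1 ⊗ₜ[k] (1 : H))) (a : A) :
    (targetMap k H).lTensor A (ρ a) = ρ 1 * (a ⊗ₜ[k] (1 : H)) := by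
  -- `E` applies the counit to the middle leg, so it undoes `ρ ⊗ id`. The identity results from
  -- evaluating `E` on `(ρ ⊗ id)(ρ(1)(a ⊗ 1))` in two ways.
  let E : (A ⊗[k] H) ⊗[k] H →ₗ[k] A ⊗[k] H :=
    ((TensorProduct.rid k A).toLinearMap ∘ₗ (ε).lTensor A).rTensor H
  have hE : ∀ z : A ⊗[k] H, E (ρ.rTensor H z) = z := by
    intro z
    induction z with
    | zero => simp
    | tmul p q => simp [E, hcounit]
    | add p q hp hq => simp only [map_add, hp, hq]
  have hr : ∀ z : A ⊗[k] H, ρ.rTensor H (z * (a ⊗ₜ[k] (1 : H))) =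
      ρ.rTensor H z * (ρ a ⊗ₜ[k] (1 : H)) := by
    intro z
    induction z with
    | zero => simp
    | tmul p q => simp [hmul]
    | add p q hp hq => simp only [map_add, add_mul, hp, hq]
  have hw : ∀ (b : A) (h : H) (w : H ⊗[k] H), E ((TensorProduct.assoc k A H H).symm
      ((1 : A) ⊗ₜ[k] w) * ((b ⊗ₜ[k] h) ⊗ₜ[k] (1 : H))) =
      b ⊗ₜ[k] TensorProduct.lid k H ((ε ∘ₗ LinearMap.mulRight k h).rTensor H w) := by
    intro b h w
    induction w with
    | zero => simp
    | tmul p q => simp [E, TensorProduct.smul_tmul]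
    | add p q hp hq => simp only [map_add, TensorProduct.tmul_add, add_mul, hp, hq]
  have hz : ∀ z : A ⊗[k] H, E ((TensorProduct.assoc k A H H).symm ((1 : A) ⊗ₜ[k] Δ 1) *
      (z ⊗ₜ[k] (1 : H))) = (targetMap k H).lTensor A z := by
    intro z
    induction z with
    | zero => simp
    | tmul p q => rw [hw]; rfl
    | add p q hp hq => simp only [map_add, TensorProduct.add_tmul, mul_add, hp, hq]
  rw [← hE (ρ 1 * _), hr, hone, mul_assoc, Algebra.TensorProduct.tmul_mul_tmul, ← hmul, one_mul,
    mul_one, hz]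

variable [WeakBialgebra k H]

theorem comul_mul_comul_one (h : H) : Δ h * Δ 1 = Δ h := by
  rw [← WeakBialgebra.comul_mul, mul_one]

theorem comul_one_mul_comul (h : H) : Δ 1 * Δ h = Δ h := by
  rw [← WeakBialgebra.comul_mul, one_mul]

/-- Apply `ε(· h)` to the first leg of the second factorisation of `Δ²(1)`, the one with `1 ⊗ Δ(1)`
on the left. -/
theorem comul_of_mem_targetSpace' {x : H} (hx : x ∈ targetSpace k H) :
    Δ x = Δ 1 * (x ⊗ₜ[k] (1 : H)) := by
  obtain ⟨h, rfl⟩ := hx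
  simp only [targetMap, LinearMap.coe_mk, AddHom.coe_mk]
  generalize ε ∘ₗ LinearMap.mulRight k h = φ
  have h1 : ∀ z : H ⊗[k] H, Δ (TensorProduct.lid k H (φ.rTensor H z)) =
      TensorProduct.lid k (H ⊗[k] H) (φ.rTensor (H ⊗[k] H) ((Δ).lTensor H z)) := by
    intro z
    induction z with
    | zero => simp
    | tmul p q => simp
    | add p q hp hq => simp only [map_add, hp, hq]
  have h2 : ∀ z w : H ⊗[k] H, TensorProduct.lid k (H ⊗[k] H) (φ.rTensor (H ⊗[k] H)
      (((1 : H) ⊗ₜ[k] w) * TensorProduct.assoc k H H H (z ⊗ₜ[k] (1 : H)))) =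
      w * (TensorProduct.lid k H (φ.rTensor H z) ⊗ₜ[k] (1 : H)) := by
    intro z w
    induction z with
    | zero => simp
    | tmul p q => simp [← TensorProduct.smul_tmul']
    | add p q hp hq => simp only [map_add, TensorProduct.add_tmul, mul_add, hp, hq]
  rw [h1, WeakBialgebra.comul_comul_one', h2]

/-- Apply `ε(h ·)` to the last leg of `Δ²(1)`; coassociativity identifies the other two legs with
`Δ(1₁)`. -/
theorem comul_sourceMap (h : H) :
    Δ (sourceMap k H h) = ((1 : H) ⊗ₜ[k] sourceMap k H h) * Δ 1 := by
  simp only [sourceMap, LinearMap.coe_mk, AddHom.coe_mk]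
  generalize ε ∘ₗ LinearMap.mulLeft k h = φ
  have h1 : ∀ z : H ⊗[k] H, Δ (TensorProduct.rid k H (φ.lTensor H z)) =
      TensorProduct.rid k (H ⊗[k] H) (φ.lTensor (H ⊗[k] H) ((Δ).rTensor H z)) := by
    intro z
    induction z with
    | zero => simp
    | tmul p q => simp
    | add p q hp hq => simp only [map_add, hp, hq]
  have h2 : ∀ z w : H ⊗[k] H, TensorProduct.rid k (H ⊗[k] H) (φ.lTensor (H ⊗[k] H)
      ((TensorProduct.assoc k H H H).symm (((1 : H) ⊗ₜ[k] z) *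
        TensorProduct.assoc k H H H (w ⊗ₜ[k] (1 : H))))) =
      ((1 : H) ⊗ₜ[k] TensorProduct.rid k H (φ.lTensor H z)) * w := by
    intro z w
    induction z with
    | zero => simp
    | tmul p q =>
      induction w with
      | zero => simp
      | tmul a b => simp [TensorProduct.tmul_smul]
      | add a b ha hb => simp only [map_add, TensorProduct.add_tmul, mul_add, ha, hb]
    | add p q hp hq => simp only [map_add, TensorProduct.tmul_add, add_mul, hp, hq]
  have h3 := Coalgebra.coassoc_symm_apply (R := k) (1 : H)
  rw [h1, ← h3, WeakBialgebra.comul_comul_one', h2]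

/-- Elements of the source and target spaces commute. -/
theorem sourceMap_mul_targetMap (g h : H) :
    sourceMap k H g * targetMap k H h = targetMap k H h * sourceMap k H g := by
  have key := (WeakBialgebra.comul_comul_one (k := k) (H := H)).symm.trans
    WeakBialgebra.comul_comul_one'
  -- Evaluating the outer legs of the two factorisations of `Δ²(1)` by `ε(· h)` and `ε(g ·)` leaves
  -- the two products in the middle leg.
  let F : H ⊗[k] (H ⊗[k] H) →ₗ[k] H := (TensorProduct.lid k H).toLinearMap ∘ₗ
    TensorProduct.map (ε ∘ₗ LinearMap.mulRight k h)
      ((TensorProduct.rid k H).toLinearMap ∘ₗ (ε ∘ₗ LinearMap.mulLeft k g).lTensor H)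
  have key' := congrArg F key
  have r := Coalgebra.Repr.arbitrary k (1 : H)
  rw [targetMap_apply_eq_sum r, sourceMap_apply_eq_sum r]
  simpa [F, ← r.eq, TensorProduct.sum_tmul, TensorProduct.tmul_sum, Finset.sum_mul_sum, smul_smul,
    mul_comm] using key'.symm

/-- The counit axiom with middle factor `1` reads `ε(hg) = ε(h1₂)ε(1₁g)`; summing over `Δ(1)` on the
left factor gives `ε_s(h)`, on the right factor `ε_t(g)`. -/
theorem counit_sourceMap_mul (h g : H) : ε (sourceMap k H h * g) = ε (h * g) := by
  have r := Coalgebra.Repr.arbitrary k (1 : H)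
  have := WeakBialgebra.counit_mul_mul' (k := k) h 1 g
  rw [mul_one] at this
  rw [this, sourceMap_apply_eq_sum r]
  simp [← r.eq, Finset.sum_mul, mul_comm]

theorem counit_mul_targetMap (h g : H) : ε (h * targetMap k H g) = ε (h * g) := by
  have r := Coalgebra.Repr.arbitrary k (1 : H)
  have := WeakBialgebra.counit_mul_mul' (k := k) h 1 g
  rw [mul_one] at this
  rw [this, targetMap_apply_eq_sum r]
  simp [← r.eq, Finset.mul_sum]

theorem sourceMap_sourceMap_mul (h g : H) :
    sourceMap k H (sourceMap k H h * g) = sourceMap k H (h * g) := by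
  have r := Coalgebra.Repr.arbitrary k (1 : H)
  simp only [sourceMap_apply_eq_sum r (_ * g), mul_assoc, counit_sourceMap_mul]

theorem targetMap_mul_targetMap (h g : H) :
    targetMap k H (h * targetMap k H g) = targetMap k H (h * g) := by
  have r := Coalgebra.Repr.arbitrary k (1 : H)
  simp only [targetMap_apply_eq_sum r (h * _), ← mul_assoc, counit_mul_targetMap]

/-- `h₁ ⊗ ε_t(h₂) = 1₁h ⊗ 1₂`. -/
theorem lTensor_targetMap_comul (h : H) :
    (targetMap k H).lTensor H (Δ h) = Δ 1 * (h ⊗ₜ[k] (1 : H)) := by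
  refine lTensor_targetMap_of_multiplicative Δ WeakBialgebra.comul_mul (fun a => ?_) ?_ h
  · simp
  · rw [← Coalgebra.coassoc_symm_apply, WeakBialgebra.comul_comul_one']
    generalize Δ 1 = w
    have : ∀ z : H ⊗[k] H, (TensorProduct.assoc k H H H).symm (((1 : H) ⊗ₜ[k] w) *
        TensorProduct.assoc k H H H (z ⊗ₜ[k] (1 : H))) =
        (TensorProduct.assoc k H H H).symm ((1 : H) ⊗ₜ[k] w) * (z ⊗ₜ[k] (1 : H)) := by
      intro z
      induction z with
      | zero => simp
      | tmul p q =>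
        induction w with
        | zero => simp
        | tmul a b => simp
        | add a b ha hb => simp only [map_add, TensorProduct.tmul_add, add_mul, ha, hb]
      | add p q hp hq => simp only [map_add, TensorProduct.add_tmul, mul_add, hp, hq]
    exact this w

/-- `ε_s(h₁) ⊗ h₂ = 1₁ ⊗ h1₂`. -/
theorem rTensor_sourceMap_comul (h : H) :
    (sourceMap k H).rTensor H (Δ h) = ((1 : H) ⊗ₜ[k] h) * Δ 1 := by
  let E : H ⊗[k] (H ⊗[k] H) →ₗ[k] H ⊗[k] H :=
    ((TensorProduct.lid k H).toLinearMap ∘ₗ (ε).rTensor H).lTensor H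
  have hE : ∀ z : H ⊗[k] H, E ((Δ).lTensor H z) = z := by
    intro z
    induction z with
    | zero => simp
    | tmul p q => simp [E]
    | add p q hp hq => simp only [map_add, hp, hq]
  have hl : ∀ z : H ⊗[k] H, (Δ).lTensor H (((1 : H) ⊗ₜ[k] h) * z) =
      ((1 : H) ⊗ₜ[k] Δ h) * (Δ).lTensor H z := by
    intro z
    induction z with
    | zero => simp
    | tmul p q => simp [WeakBialgebra.comul_mul]
    | add p q hp hq => simp only [map_add, mul_add, hp, hq]
  have hw : ∀ (a b : H) (w : H ⊗[k] H), E (((1 : H) ⊗ₜ[k] (a ⊗ₜ[k] b)) *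
      TensorProduct.assoc k H H H (w ⊗ₜ[k] (1 : H))) =
      TensorProduct.rid k H ((ε ∘ₗ LinearMap.mulLeft k a).lTensor H w) ⊗ₜ[k] b := by
    intro a b w
    induction w with
    | zero => simp
    | tmul p q => simp [E, TensorProduct.smul_tmul]
    | add p q hp hq => simp only [map_add, TensorProduct.add_tmul, mul_add, hp, hq]
  have hz : ∀ z : H ⊗[k] H, E (((1 : H) ⊗ₜ[k] z) *
      TensorProduct.assoc k H H H (Δ 1 ⊗ₜ[k] (1 : H))) = (sourceMap k H).rTensor H z := by
    intro z
    induction z with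
    | zero => simp
    | tmul p q => rw [hw]; rfl
    | add p q hp hq => simp only [map_add, TensorProduct.tmul_add, add_mul, hp, hq]
  rw [← hE (_ * Δ 1), hl, WeakBialgebra.comul_comul_one', ← mul_assoc,
    Algebra.TensorProduct.tmul_mul_tmul, comul_mul_comul_one, mul_one, hz]

/-- `ε(ax₁)x₂ = ε(a1₁)1₂x`. -/
theorem counit_mul_comul (a x : H) :
    TensorProduct.lid k H ((ε ∘ₗ LinearMap.mulLeft k a).rTensor H (Δ x)) =
      TensorProduct.lid k H ((ε ∘ₗ LinearMap.mulLeft k a).rTensor H (Δ 1)) * x := by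
  let F : H ⊗[k] H → H ⊗[k] (H ⊗[k] H) →ₗ[k] H := fun w => (TensorProduct.lid k H).toLinearMap ∘ₗ
    TensorProduct.map (ε ∘ₗ LinearMap.mulLeft k a)
      ((TensorProduct.lid k H).toLinearMap ∘ₗ (ε).rTensor H ∘ₗ LinearMap.mulRight k w)
  have hF : ∀ b c t, F (b + c) t = F b t + F c t := by
    intro b c t
    induction t with
    | zero => simp
    | tmul p q => simp [F, mul_add]
    | add p q hp hq => simp only [map_add, hp, hq]; abel
  -- The axiom splits `ε(apb)` as `ε(ap₁)ε(p₂b)`. For `z = Δ(1)` and `w = Δ(x)`, coassociativity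
  -- lets the second counit be absorbed into `Δ(1₂x)`.
  have h1 : ∀ z w : H ⊗[k] H,
      TensorProduct.lid k H ((ε ∘ₗ LinearMap.mulLeft k a).rTensor H (z * w)) =
      F w (TensorProduct.assoc k H H H ((Δ).rTensor H z)) := by
    intro z w
    induction z with
    | zero => simp
    | add p q hp hq => simp only [map_add, add_mul, hp, hq]
    | tmul p q =>
      induction w with
      | zero => simp [F]
      | add b c hb hc =>
        rw [mul_add, map_add, map_add, hb, hc]
        rw [hF]
      | tmul b c =>
        have := WeakBialgebra.counit_mul_mul (k := k) a p b
        have r := Coalgebra.Repr.arbitrary k p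
        rw [← r.eq] at this
        simp only [LinearMap.rTensor_tmul, ← r.eq]
        simp [F, TensorProduct.sum_tmul, ← mul_assoc, this, smul_smul, mul_comm (ε (a * _))]
  have h2 : ∀ z : H ⊗[k] H, F (Δ x) ((Δ).lTensor H z) =
      TensorProduct.lid k H ((ε ∘ₗ LinearMap.mulLeft k a).rTensor H z) * x := by
    intro z
    induction z with
    | zero => simp
    | tmul p q => simp [F, ← WeakBialgebra.comul_mul]
    | add p q hp hq => simp only [map_add, add_mul, hp, hq]
  rw [← h2, ← Coalgebra.coassoc_apply, ← h1, comul_one_mul_comul]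

/-- `ε_t(x₁) ⊗ x₂ = ε_t(1₁) ⊗ 1₂x`. -/
theorem rTensor_targetMap_comul (x : H) :
    (targetMap k H).rTensor H (Δ x) =
      (targetMap k H).rTensor H (Δ 1) * ((1 : H) ⊗ₜ[k] x) := by
  have r := Coalgebra.Repr.arbitrary k (1 : H)
  -- Expanding `ε_t` by a second copy of `Δ(1)` reduces the claim to `counit_mul_comul` at each left
  -- leg.
  have h1 : ∀ z : H ⊗[k] H, (targetMap k H).rTensor H z = ∑ i ∈ r.index, r.right i ⊗ₜ[k]
      TensorProduct.lid k H ((ε ∘ₗ LinearMap.mulLeft k (r.left i)).rTensor H z) := by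
    intro z
    induction z with
    | zero => simp
    | tmul p q => simp [targetMap_apply_eq_sum r, TensorProduct.sum_tmul, TensorProduct.smul_tmul]
    | add p q hp hq => simp only [map_add, TensorProduct.tmul_add, Finset.sum_add_distrib, hp, hq]
  rw [h1, h1, Finset.sum_mul]
  refine Finset.sum_congr rfl fun i _ => ?_
  rw [Algebra.TensorProduct.tmul_mul_tmul, mul_one, counit_mul_comul]

/-- `ε_s(h₁) ⊗ ε_t(h₂) = ε_s(h₂) ⊗ ε_t(h₁)`. -/
theorem map_sourceMap_targetMap_comul (h : H) :
    TensorProduct.map (sourceMap k H) (targetMap k H) (Δ h) =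
      TensorProduct.comm k H H (TensorProduct.map (targetMap k H) (sourceMap k H) (Δ h)) := by
  have r := Coalgebra.Repr.arbitrary k (1 : H)
  have h1 : TensorProduct.map (sourceMap k H) (targetMap k H) (Δ h) =
      (targetMap k H).lTensor H ((sourceMap k H).rTensor H (Δ h)) := by
    rw [← LinearMap.comp_apply (LinearMap.lTensor _ _), LinearMap.lTensor_comp_rTensor]
  have h2 : ∀ z : H ⊗[k] H, TensorProduct.map (targetMap k H) (sourceMap k H) z =
      ∑ i ∈ r.index, ∑ j ∈ r.index, LinearMap.mul' k k (TensorProduct.map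
        (ε ∘ₗ LinearMap.mulLeft k (r.left j)) (ε ∘ₗ LinearMap.mulRight k (r.right i)) z) •
        (r.right j ⊗ₜ[k] r.left i) := by
    intro z
    induction z with
    | zero => simp
    | tmul p q =>
      simp only [TensorProduct.map_tmul, targetMap_apply_eq_sum r, sourceMap_apply_eq_sum r,
        TensorProduct.sum_tmul, TensorProduct.tmul_sum]
      simp [TensorProduct.smul_tmul, TensorProduct.tmul_smul, smul_smul, mul_comm]
    | add p q hp hq =>
      simp only [map_add, add_smul, Finset.sum_add_distrib, hp, hq]
  rw [h1, rTensor_sourceMap_comul, h2]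
  -- Both sides become `1₁ ⊗ ε(1'₁h1₂)1'₂`.
  simp only [← WeakBialgebra.counit_mul_mul]
  conv_lhs => rw [← r.eq]
  simp [Finset.mul_sum, targetMap_apply_eq_sum r, TensorProduct.tmul_sum, mul_assoc]

end WeakBialgebra

/-! ### Convolution -/

section Convolution

open WithConv

variable {k : Type u} [Field k] {C : Type*} [AddCommGroup C] [Module k C] [Coalgebra k C]
  {R : Type*} [Ring R] [Algebra k R]

variable (k C) in
/-- The element `c ↦ ε(c)r` of the convolution algebra. -/
def convConst (r : R) : WithConv (C →ₗ[k] R) :=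
  toConv ((Coalgebra.counit (R := k) (A := C)).smulRight r)

/-- Constants act pointwise by counitality, so an expression such as `h₁rS(h₂)` is a product in an
associative convolution algebra. -/
theorem convConst_mul_apply (r : R) (f : WithConv (C →ₗ[k] R)) (c : C) :
    (convConst k C r * f) c = r * f c := by
  have h : ∀ z : C ⊗[k] C, LinearMap.mul' k R (TensorProduct.map
      ((Coalgebra.counit (R := k) (A := C)).smulRight r) f.ofConv z) =
      r * f.ofConv (TensorProduct.lid k C ((Coalgebra.counit (R := k) (A := C)).rTensor C z)) := by
    intro z
    induction z with
    | zero => simp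
    | tmul p q => simp
    | add p q hp hq => simp only [map_add, mul_add, hp, hq]
  simpa [convConst] using h (Coalgebra.comul (R := k) c)

theorem mul_convConst_apply (r : R) (f : WithConv (C →ₗ[k] R)) (c : C) :
    (f * convConst k C r) c = f c * r := by
  have h : ∀ z : C ⊗[k] C, LinearMap.mul' k R (TensorProduct.map f.ofConv
      ((Coalgebra.counit (R := k) (A := C)).smulRight r) z) =
      f.ofConv (TensorProduct.rid k C ((Coalgebra.counit (R := k) (A := C)).lTensor C z)) * r := by
    intro z
    induction z with
    | zero => simp
    | tmul p q => simp
    | add p q hp hq => simp only [map_add, add_mul, hp, hq]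
  simpa [convConst] using h (Coalgebra.comul (R := k) c)

/-- A relative inverse is unique. -/
theorem eq_of_relative_inverse {R : Type*} [Semigroup R] {x y y' : R} (hy : y * x * y = y)
    (hy' : y' * x * y' = y') (hl : y * x = y' * x) (hr : x * y = x * y') : y = y' := by
  rw [← hy, hl, mul_assoc, hr, ← mul_assoc, hy']

end Convolution

/-! ### The antipode of a weak Hopf algebra -/

section WeakHopfAlgebra

open WithConv

variable {k : Type u} {H : Type v} [Field k] [Ring H] [Algebra k H] [Coalgebra k H]
  [WeakHopfAlgebra k H]

local notation "Δ" => Coalgebra.comul (R := k) (A := H)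
local notation "ε" => Coalgebra.counit (R := k) (A := H)
local notation "𝒮" => WeakHopfAlgebra.antipode (k := k) (H := H)
local notation "εs" => sourceMap k H
local notation "εt" => targetMap k H

theorem toConv_antipode_mul_id : toConv 𝒮 * toConv LinearMap.id = toConv εs :=
  congrArg toConv WeakHopfAlgebra.antipode_conv_id

theorem toConv_id_mul_antipode : toConv LinearMap.id * toConv 𝒮 = toConv εt :=
  congrArg toConv WeakHopfAlgebra.id_conv_antipode

theorem toConv_sourceMap_mul_antipode : toConv εs * toConv 𝒮 = toConv 𝒮 := by
  rw [← toConv_antipode_mul_id]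
  exact congrArg toConv WeakHopfAlgebra.antipode_conv_id_conv_antipode

theorem toConv_antipode_mul_targetMap : toConv 𝒮 * toConv εt = toConv 𝒮 := by
  rw [← toConv_id_mul_antipode, ← mul_assoc, toConv_antipode_mul_id,
    toConv_sourceMap_mul_antipode]

theorem mul'_map_id_antipode_comul (h : H) :
    LinearMap.mul' k H (TensorProduct.map LinearMap.id 𝒮 (Δ h)) = εt h :=
  LinearMap.congr_fun WeakHopfAlgebra.id_conv_antipode h

theorem mul'_map_antipode_id_comul (h : H) :
    LinearMap.mul' k H (TensorProduct.map 𝒮 LinearMap.id (Δ h)) = εs h :=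
  LinearMap.congr_fun WeakHopfAlgebra.antipode_conv_id h

/-- `h₁ε_t(g)S(h₂) = ε_t(hg)`. -/
theorem id_mul_convConst_mul_antipode_apply (h g : H) :
    (toConv (LinearMap.id : H →ₗ[k] H) * (convConst k H (εt g) * toConv 𝒮)).ofConv h =
      εt (h * g) := by
  have h1 : ∀ z : H ⊗[k] H, LinearMap.mul' k H (TensorProduct.map LinearMap.id
      (convConst k H (εt g) * toConv 𝒮).ofConv z) = LinearMap.mul' k H
      (TensorProduct.map LinearMap.id 𝒮 (z * (εt g ⊗ₜ[k] 1))) := by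
    intro z
    induction z with
    | zero => simp
    | tmul p q =>
      rw [TensorProduct.map_tmul, convConst_mul_apply]
      simp [mul_assoc]
    | add p q hp hq => simp only [map_add, add_mul, hp, hq]
  rw [LinearMap.convMul_apply]
  refine (h1 _).trans ?_
  -- Inserting `Δ(1)` turns `Δ(h)(ε_t(g) ⊗ 1)` into `Δ(hε_t(g))`, to which `id * S = ε_t` applies.
  rw [← comul_mul_comul_one, mul_assoc, ← comul_of_mem_targetSpace' ⟨g, rfl⟩,
    ← WeakBialgebra.comul_mul, mul'_map_id_antipode_comul, targetMap_mul_targetMap]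

/-- `S(g₁)ε_s(h)g₂ = ε_s(hg)`. -/
theorem antipode_mul_convConst_mul_id_apply (h g : H) :
    (toConv 𝒮 * (convConst k H (εs h) * toConv (LinearMap.id : H →ₗ[k] H))).ofConv g =
      εs (h * g) := by
  have h1 : ∀ z : H ⊗[k] H, LinearMap.mul' k H (TensorProduct.map 𝒮
      (convConst k H (εs h) * toConv LinearMap.id).ofConv z) = LinearMap.mul' k H
      (TensorProduct.map 𝒮 LinearMap.id ((1 ⊗ₜ[k] εs h) * z)) := by
    intro z
    induction z with
    | zero => simp
    | tmul p q =>
      rw [TensorProduct.map_tmul, convConst_mul_apply]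
      simp
    | add p q hp hq => simp only [map_add, mul_add, hp, hq]
  rw [LinearMap.convMul_apply]
  refine (h1 _).trans ?_
  rw [← comul_one_mul_comul, ← mul_assoc, ← comul_sourceMap,
    ← WeakBialgebra.comul_mul, mul'_map_antipode_id_comul, sourceMap_sourceMap_mul]

/-- The map `h ⊗ g ↦ f(h)ε(g)`. -/
def convFst (f : WithConv (H →ₗ[k] H)) : WithConv (H ⊗[k] H →ₗ[k] H) :=
  toConv (f.ofConv ∘ₗ (TensorProduct.rid k H).toLinearMap ∘ₗ (ε).lTensor H)

/-- The map `h ⊗ g ↦ ε(h)f(g)`. -/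
def convSnd (f : WithConv (H →ₗ[k] H)) : WithConv (H ⊗[k] H →ₗ[k] H) :=
  toConv (f.ofConv ∘ₗ (TensorProduct.lid k H).toLinearMap ∘ₗ (ε).rTensor H)

/-! ### Convolution calculus for maps `H ⊗ H → H` -/

section

omit [WeakHopfAlgebra k H]

@[simp]
theorem convFst_tmul (f : WithConv (H →ₗ[k] H)) (h g : H) :
    (convFst f).ofConv (h ⊗ₜ[k] g) = ε g • f.ofConv h := by
  simp [convFst]

@[simp]
theorem convSnd_tmul (f : WithConv (H →ₗ[k] H)) (h g : H) :
    (convSnd f).ofConv (h ⊗ₜ[k] g) = ε h • f.ofConv g := by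
  simp [convSnd]

theorem convMul_apply_tmul (F G : WithConv (H ⊗[k] H →ₗ[k] H)) (h g : H) {ι κ : Type*}
    (r : Coalgebra.Repr k h ι) (s : Coalgebra.Repr k g κ) : (F * G).ofConv (h ⊗ₜ[k] g) =
      ∑ i ∈ r.index, ∑ j ∈ s.index,
        F.ofConv (r.left i ⊗ₜ[k] s.left j) * G.ofConv (r.right i ⊗ₜ[k] s.right j) := by
  rw [LinearMap.convMul_apply, TensorProduct.comul_tmul, ← r.eq, ← s.eq, Finset.sum_comm]
  simp [TensorProduct.sum_tmul, TensorProduct.tmul_sum]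

theorem convFst_mul_apply (f : WithConv (H →ₗ[k] H)) (G : WithConv (H ⊗[k] H →ₗ[k] H))
    (h g : H) : (convFst f * G).ofConv (h ⊗ₜ[k] g) =
      (f * toConv (G.ofConv ∘ₗ (TensorProduct.mk k H H).flip g)).ofConv h := by
  have r := Coalgebra.Repr.arbitrary k h
  have s := Coalgebra.Repr.arbitrary k g
  rw [convMul_apply_tmul _ _ _ _ r s, r.convMul_apply]
  refine Finset.sum_congr rfl fun i _ => ?_
  conv_rhs => rw [← Coalgebra.sum_counit_smul s]
  simp [Finset.mul_sum]

theorem convSnd_mul_apply (f : WithConv (H →ₗ[k] H)) (G : WithConv (H ⊗[k] H →ₗ[k] H))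
    (h g : H) : (convSnd f * G).ofConv (h ⊗ₜ[k] g) =
      (f * toConv (G.ofConv ∘ₗ TensorProduct.mk k H H h)).ofConv g := by
  have r := Coalgebra.Repr.arbitrary k h
  have s := Coalgebra.Repr.arbitrary k g
  rw [convMul_apply_tmul _ _ _ _ r s, s.convMul_apply, Finset.sum_comm]
  refine Finset.sum_congr rfl fun i _ => ?_
  conv_rhs => rw [← Coalgebra.sum_counit_smul r]
  simp [Finset.mul_sum]

/-- Precomposition with the coalgebra map `id ⊗ ε` respects convolution. -/
theorem convFst_mul (f g : WithConv (H →ₗ[k] H)) :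
    convFst (f * g) = convFst f * convFst g := by
  refine WithConv.ext (TensorProduct.ext' fun x y => ?_)
  have : (toConv ((convFst g).ofConv ∘ₗ (TensorProduct.mk k H H).flip y) :
      WithConv (H →ₗ[k] H)) = ε y • g := by ext; simp
  rw [convFst_mul_apply, this, mul_smul_comm, convFst_tmul]
  rfl

theorem convSnd_mul (f g : WithConv (H →ₗ[k] H)) :
    convSnd (f * g) = convSnd f * convSnd g := by
  refine WithConv.ext (TensorProduct.ext' fun x y => ?_)
  have : (toConv ((convSnd g).ofConv ∘ₗ TensorProduct.mk k H H x) :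
      WithConv (H →ₗ[k] H)) = ε x • g := by ext; simp
  rw [convSnd_mul_apply, this, mul_smul_comm, convSnd_tmul]
  rfl

theorem convFst_mul_convSnd_apply (f g : WithConv (H →ₗ[k] H)) (x y : H) :
    (convFst f * convSnd g).ofConv (x ⊗ₜ[k] y) = f.ofConv x * g.ofConv y := by
  have : (toConv ((convSnd g).ofConv ∘ₗ (TensorProduct.mk k H H).flip y) :
      WithConv (H →ₗ[k] H)) = convConst k H (g.ofConv y) := by ext; simp [convConst]
  rw [convFst_mul_apply, this, mul_convConst_apply]

theorem convSnd_mul_convFst_apply (f g : WithConv (H →ₗ[k] H)) (x y : H) :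
    (convSnd f * convFst g).ofConv (x ⊗ₜ[k] y) = f.ofConv y * g.ofConv x := by
  have : (toConv ((convFst g).ofConv ∘ₗ TensorProduct.mk k H H x) :
      WithConv (H →ₗ[k] H)) = convConst k H (g.ofConv x) := by ext; simp [convConst]
  rw [convSnd_mul_apply, this, mul_convConst_apply]

theorem convFst_mul_convSnd_mul_convFst_apply (f g f' : WithConv (H →ₗ[k] H)) (x y : H) :
    (convFst f * (convSnd g * convFst f')).ofConv (x ⊗ₜ[k] y) =
      (f * (convConst k H (g.ofConv y) * f')).ofConv x := by
  rw [convFst_mul_apply]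
  congr 3
  ext z
  rw [convConst_mul_apply]
  exact convSnd_mul_convFst_apply _ _ _ _

theorem convSnd_mul_convFst_mul_convSnd_apply (f g f' : WithConv (H →ₗ[k] H)) (x y : H) :
    (convSnd f * (convFst g * convSnd f')).ofConv (x ⊗ₜ[k] y) =
      (f * (convConst k H (g.ofConv x) * f')).ofConv y := by
  rw [convSnd_mul_apply]
  congr 3
  ext z
  rw [convConst_mul_apply]
  exact convFst_mul_convSnd_apply _ _ _ _

end

omit [WeakHopfAlgebra k H] in
-- Only multiplicativity of `Δ` matters here; `ε` need not be multiplicative, so the product map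
-- need not be a coalgebra map.
theorem toConv_comp_mul'_mul [WeakBialgebra k H] (f g : H →ₗ[k] H) :
    toConv (f ∘ₗ LinearMap.mul' k H) * toConv (g ∘ₗ LinearMap.mul' k H) =
      toConv ((toConv f * toConv g).ofConv ∘ₗ LinearMap.mul' k H) := by
  refine WithConv.ext (TensorProduct.ext' fun x y => ?_)
  have r := Coalgebra.Repr.arbitrary k x
  have s := Coalgebra.Repr.arbitrary k y
  rw [convMul_apply_tmul _ _ _ _ r s]
  simp only [LinearMap.comp_apply, LinearMap.mul'_apply, LinearMap.convMul_apply,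
    WeakBialgebra.comul_mul]
  rw [← r.eq, ← s.eq, Finset.sum_mul_sum]
  simp

/-- The antipode is antimultiplicative. -/
theorem antipode_mul (h g : H) : 𝒮 (h * g) = 𝒮 g * 𝒮 h := by
  have hX : toConv (LinearMap.id ∘ₗ LinearMap.mul' k H) =
      convFst (toConv LinearMap.id) * convSnd (toConv LinearMap.id) :=
    WithConv.ext (TensorProduct.ext' fun x y => by
      rw [convFst_mul_convSnd_apply]; simp)
  have hcomm : convFst (toConv εs) * convSnd (toConv εt) =
      convSnd (toConv εt) * convFst (toConv εs) := by
    refine WithConv.ext (TensorProduct.ext' fun x y => ?_)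
    rw [convFst_mul_convSnd_apply, convSnd_mul_convFst_apply]
    exact sourceMap_mul_targetMap x y
  -- Both sides are relative inverses of the multiplication map in the convolution algebra of maps
  -- `H ⊗ H → H`.
  have key : toConv (𝒮 ∘ₗ LinearMap.mul' k H) = convSnd (toConv 𝒮) * convFst (toConv 𝒮) := by
    refine eq_of_relative_inverse (x := toConv (LinearMap.id ∘ₗ LinearMap.mul' k H)) ?_ ?_ ?_ ?_
    · rw [toConv_comp_mul'_mul, toConv_antipode_mul_id, toConv_comp_mul'_mul,
        toConv_sourceMap_mul_antipode]
    -- Regrouping produces `ε_s` of one variable next to `ε_t` of the other; these commute, and each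
    -- is absorbed by a factor `S`.
    · rw [hX, show ∀ a b c d : WithConv (H ⊗[k] H →ₗ[k] H), a * b * (c * d) * (a * b) =
        a * ((b * c) * (d * a)) * b by intros; simp only [mul_assoc], ← convFst_mul,
        ← convSnd_mul, toConv_antipode_mul_id, toConv_id_mul_antipode, hcomm, ← mul_assoc,
        ← convSnd_mul, mul_assoc, ← convFst_mul, toConv_antipode_mul_targetMap,
        toConv_sourceMap_mul_antipode]
    · rw [toConv_comp_mul'_mul, toConv_antipode_mul_id, hX,
        show ∀ a b c d : WithConv (H ⊗[k] H →ₗ[k] H), a * b * (c * d) =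
        a * ((b * c) * d) by intros; simp only [mul_assoc], ← convFst_mul, toConv_antipode_mul_id]
      refine WithConv.ext (TensorProduct.ext' fun x y => ?_)
      rw [convSnd_mul_convFst_mul_convSnd_apply]
      exact (antipode_mul_convConst_mul_id_apply x y).symm
    · rw [toConv_comp_mul'_mul, toConv_id_mul_antipode, hX,
        show ∀ a b c d : WithConv (H ⊗[k] H →ₗ[k] H), a * b * (c * d) =
        a * ((b * c) * d) by intros; simp only [mul_assoc], ← convSnd_mul, toConv_id_mul_antipode]
      refine WithConv.ext (TensorProduct.ext' fun x y => ?_)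
      rw [convFst_mul_convSnd_mul_convFst_apply]
      exact (id_mul_convConst_mul_antipode_apply x y).symm
  have := congrArg (fun f => f.ofConv (h ⊗ₜ[k] g)) key
  rwa [convSnd_mul_convFst_apply] at this

/-- The map `h ↦ f(h) ⊗ 1`. -/
def convInl (f : WithConv (H →ₗ[k] H)) : WithConv (H →ₗ[k] H ⊗[k] H) :=
  toConv ((Algebra.TensorProduct.includeLeft : H →ₐ[k] H ⊗[k] H).toLinearMap ∘ₗ f.ofConv)

/-- The map `h ↦ 1 ⊗ f(h)`. -/
def convInr (f : WithConv (H →ₗ[k] H)) : WithConv (H →ₗ[k] H ⊗[k] H) :=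
  toConv ((Algebra.TensorProduct.includeRight : H →ₐ[k] H ⊗[k] H).toLinearMap ∘ₗ f.ofConv)

/-! ### Convolution calculus for maps `H → H ⊗ H` -/

section

omit [WeakHopfAlgebra k H]

theorem convInl_mul (f g : WithConv (H →ₗ[k] H)) :
    convInl (f * g) = convInl f * convInl g :=
  WithConv.ext (LinearMap.algHom_comp_convMul_distrib _ f g)

theorem convInr_mul (f g : WithConv (H →ₗ[k] H)) :
    convInr (f * g) = convInr f * convInr g :=
  WithConv.ext (LinearMap.algHom_comp_convMul_distrib _ f g)

theorem convInl_mul_convInr_apply (f g : WithConv (H →ₗ[k] H)) (h : H) :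
    (convInl f * convInr g).ofConv h = TensorProduct.map f.ofConv g.ofConv (Δ h) := by
  have r := Coalgebra.Repr.arbitrary k h
  rw [r.convMul_apply, ← r.eq]
  simp [convInl, convInr]

theorem convInr_mul_convInl_apply (f g : WithConv (H →ₗ[k] H)) (h : H) :
    (convInr f * convInl g).ofConv h =
      TensorProduct.comm k H H (TensorProduct.map f.ofConv g.ofConv (Δ h)) := by
  have r := Coalgebra.Repr.arbitrary k h
  rw [r.convMul_apply, ← r.eq]
  simp [convInl, convInr]

theorem toConv_comul_comp_mul [WeakBialgebra k H] (f g : WithConv (H →ₗ[k] H)) :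
    toConv (Δ ∘ₗ f.ofConv) * toConv (Δ ∘ₗ g.ofConv) = toConv (Δ ∘ₗ (f * g).ofConv) := by
  refine WithConv.ext (LinearMap.ext fun h => ?_)
  have r := Coalgebra.Repr.arbitrary k h
  rw [r.convMul_apply]
  simp only [LinearMap.comp_apply]
  rw [r.convMul_apply, map_sum]
  simp [WeakBialgebra.comul_mul]

end

/-- Both sides are relative inverses of `Δ` in the convolution algebra of maps `H → H ⊗ H`. The
argument is dual to antimultiplicativity, with `map_sourceMap_targetMap_comul` as the commutation
rule. -/
theorem toConv_comul_comp_antipode :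
    toConv (Δ ∘ₗ 𝒮) = convInr (toConv 𝒮) * convInl (toConv 𝒮) := by
  have hX : toConv (Δ ∘ₗ (toConv (LinearMap.id : H →ₗ[k] H)).ofConv) =
      convInl (toConv LinearMap.id) * convInr (toConv LinearMap.id) :=
    WithConv.ext (LinearMap.ext fun x => by rw [convInl_mul_convInr_apply]; simp)
  have hcomm : convInl (toConv εs) * convInr (toConv εt) =
      convInr (toConv εt) * convInl (toConv εs) := by
    refine WithConv.ext (LinearMap.ext fun x => ?_)
    rw [convInl_mul_convInr_apply, convInr_mul_convInl_apply]
    exact map_sourceMap_targetMap_comul x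
  have hs : convInl (toConv εs) * convInr (toConv LinearMap.id) =
      convInr (toConv LinearMap.id) * convConst k H (Δ 1) := by
    refine WithConv.ext (LinearMap.ext fun x => ?_)
    rw [convInl_mul_convInr_apply, mul_convConst_apply]
    exact rTensor_sourceMap_comul x
  have ht : convInl (toConv LinearMap.id) * convInr (toConv εt) =
      convConst k H (Δ 1) * convInl (toConv LinearMap.id) := by
    refine WithConv.ext (LinearMap.ext fun x => ?_)
    rw [convInl_mul_convInr_apply, convConst_mul_apply]
    exact lTensor_targetMap_comul x
  refine eq_of_relative_inverse
    (x := toConv (Δ ∘ₗ (toConv (LinearMap.id : H →ₗ[k] H)).ofConv)) ?_ ?_ ?_ ?_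
  · have h := toConv_comul_comp_mul (k := k) (H := H)
    rw [show 𝒮 = (toConv 𝒮).ofConv from rfl, h, toConv_antipode_mul_id, h,
      toConv_sourceMap_mul_antipode]
  · rw [hX, show ∀ a b c d : WithConv (H →ₗ[k] H ⊗[k] H), a * b * (c * d) * (a * b) =
        a * ((b * c) * (d * a)) * b by intros; simp only [mul_assoc], ← convInl_mul,
        ← convInr_mul, toConv_antipode_mul_id, toConv_id_mul_antipode, hcomm, ← mul_assoc,
        ← convInr_mul, mul_assoc, ← convInl_mul, toConv_antipode_mul_targetMap,
        toConv_sourceMap_mul_antipode]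
  · have h := toConv_comul_comp_mul (k := k) (H := H)
    rw [show 𝒮 = (toConv 𝒮).ofConv from rfl, h, toConv_antipode_mul_id, hX,
        show ∀ a b c d : WithConv (H →ₗ[k] H ⊗[k] H), a * b * (c * d) =
        a * ((b * c) * d) by intros; simp only [mul_assoc], ← convInl_mul, toConv_antipode_mul_id,
        hs, ← mul_assoc, ← convInr_mul, toConv_antipode_mul_id]
    refine WithConv.ext (LinearMap.ext fun x => ?_)
    rw [mul_convConst_apply]
    exact comul_sourceMap x
  · have h := toConv_comul_comp_mul (k := k) (H := H)
    rw [show 𝒮 = (toConv 𝒮).ofConv from rfl, h, toConv_id_mul_antipode, hX,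
        show ∀ a b c d : WithConv (H →ₗ[k] H ⊗[k] H), a * b * (c * d) =
        a * ((b * c) * d) by intros; simp only [mul_assoc], ← convInr_mul, toConv_id_mul_antipode,
        ← mul_assoc, ht, mul_assoc, ← convInl_mul, toConv_id_mul_antipode]
    refine WithConv.ext (LinearMap.ext fun x => ?_)
    rw [convConst_mul_apply]
    exact comul_of_mem_targetSpace' ⟨x, rfl⟩

/-- The antipode is anticomultiplicative. -/
theorem comul_antipode (h : H) :
    Δ (𝒮 h) = TensorProduct.comm k H H (TensorProduct.map 𝒮 𝒮 (Δ h)) := by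
  have := congrArg (fun f => f.ofConv h) (toConv_comul_comp_antipode (k := k) (H := H))
  rwa [convInr_mul_convInl_apply] at this

/-- `S` and `ε_t` agree on the source space. -/
theorem targetMap_sourceMap (h : H) : εt (εs h) = 𝒮 (εs h) := by
  rw [← mul'_map_id_antipode_comul, comul_sourceMap]
  have : ∀ z : H ⊗[k] H, LinearMap.mul' k H (TensorProduct.map LinearMap.id 𝒮
      (((1 : H) ⊗ₜ[k] εs h) * z)) =
      LinearMap.mul' k H (TensorProduct.map LinearMap.id 𝒮 z) * 𝒮 (εs h) := by
    intro z
    induction z with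
    | zero => simp
    | tmul p q => simp [antipode_mul, mul_assoc]
    | add p q hp hq => simp only [map_add, mul_add, add_mul, hp, hq]
  rw [this, mul'_map_id_antipode_comul, targetMap_one, one_mul]

variable (k H) in
theorem antipode_one : 𝒮 (1 : H) = 1 := by
  have := targetMap_sourceMap (k := k) (1 : H)
  rwa [sourceMap_one, targetMap_one, eq_comm] at this

variable (k H) in
-- Anticomultiplicativity at `1`, since `S(1) = 1`; applied twice, it shows that `S² ⊗ S²` fixes
-- `Δ(1)`.
theorem map_antipode_antipode_comul_one :
    TensorProduct.map 𝒮 𝒮 (Δ 1) = TensorProduct.comm k H H (Δ 1) := by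
  have h := comul_antipode (k := k) (1 : H)
  rw [antipode_one] at h
  conv_rhs => rw [h]
  exact ((TensorProduct.comm k H H).symm_apply_apply _).symm

end WeakHopfAlgebra

/-! ### Integrals in the dual of a weak Hopf algebra -/

section Integral

open WithConv

variable {k : Type u} {H : Type v} [Field k] [Ring H] [Algebra k H] [Coalgebra k H]

local notation "Δ" => Coalgebra.comul (R := k) (A := H)
local notation "ε" => Coalgebra.counit (R := k) (A := H)
local notation "𝒮" => WeakHopfAlgebra.antipode (k := k) (H := H)
local notation "εs" => sourceMap k H
local notation "εt" => targetMap k H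

/-- The operator `h ↦ θ(h₁)h₂`. -/
def hitLeft (θ : H →ₗ[k] k) : H →ₗ[k] H :=
  (TensorProduct.lid k H).toLinearMap ∘ₗ θ.rTensor H ∘ₗ Δ

/-- The operator `h ↦ h₁φ(h₂)`. -/
def hitRight (φ : H →ₗ[k] k) : H →ₗ[k] H :=
  (TensorProduct.rid k H).toLinearMap ∘ₗ φ.lTensor H ∘ₗ Δ

theorem hitRight_hitLeft (θ φ : H →ₗ[k] k) (h : H) :
    hitRight φ (hitLeft θ h) = hitLeft θ (hitRight φ h) := by
  have h1 : ∀ z : H ⊗[k] H, hitRight φ (TensorProduct.lid k H (θ.rTensor H z)) =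
      TensorProduct.rid k H (φ.lTensor H (TensorProduct.lid k (H ⊗[k] H)
        (θ.rTensor (H ⊗[k] H) ((Δ).lTensor H z)))) := by
    intro z
    induction z with
    | zero => simp
    | tmul p q => simp [hitRight]
    | add p q hp hq => simp only [map_add, hp, hq]
  have h2 : ∀ z : H ⊗[k] H, hitLeft θ (TensorProduct.rid k H (φ.lTensor H z)) =
      TensorProduct.lid k H (θ.rTensor H (TensorProduct.rid k (H ⊗[k] H)
        (φ.lTensor (H ⊗[k] H) ((Δ).rTensor H z)))) := by
    intro z
    induction z with
    | zero => simp
    | tmul p q => simp [hitLeft]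
    | add p q hp hq => simp only [map_add, hp, hq]
  have h3 : ∀ z : (H ⊗[k] H) ⊗[k] H, TensorProduct.rid k H (φ.lTensor H
      (TensorProduct.lid k (H ⊗[k] H) (θ.rTensor (H ⊗[k] H) (TensorProduct.assoc k H H H z)))) =
      TensorProduct.lid k H (θ.rTensor H (TensorProduct.rid k (H ⊗[k] H)
        (φ.lTensor (H ⊗[k] H) z))) := by
    intro z
    induction z with
    | zero => simp
    | tmul p q =>
      induction p with
      | zero => simp
      | tmul a b => simp [smul_comm (φ q)]
      | add a b ha hb => simp only [map_add, TensorProduct.add_tmul, ha, hb]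
    | add p q hp hq => simp only [map_add, hp, hq]
  refine (h1 (Δ h)).trans (Eq.trans ?_ (h2 (Δ h)).symm)
  rw [← h3, Coalgebra.coassoc_apply]

/-- Coassociativity; note the reversal of order in the convolution product. -/
theorem hitLeft_hitLeft (α β : H →ₗ[k] k) (h : H) :
    hitLeft α (hitLeft β h) = hitLeft (toConv β * toConv α).ofConv h := by
  have h1 : ∀ z : H ⊗[k] H, hitLeft α (TensorProduct.lid k H (β.rTensor H z)) =
      TensorProduct.lid k H (α.rTensor H (TensorProduct.lid k (H ⊗[k] H)
        (β.rTensor (H ⊗[k] H) ((Δ).lTensor H z)))) := by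
    intro z
    induction z with
    | zero => simp
    | tmul p q => simp [hitLeft]
    | add p q hp hq => simp only [map_add, hp, hq]
  have h2 : ∀ z : (H ⊗[k] H) ⊗[k] H, TensorProduct.lid k H (α.rTensor H
      (TensorProduct.lid k (H ⊗[k] H) (β.rTensor (H ⊗[k] H) (TensorProduct.assoc k H H H z)))) =
      TensorProduct.lid k H ((LinearMap.mul' k k ∘ₗ TensorProduct.map β α).rTensor H z) := by
    intro z
    induction z with
    | zero => simp
    | tmul p q =>
      induction p with
      | zero => simp
      | tmul a b => simp [smul_smul, mul_comm]
      | add a b ha hb => simp only [map_add, TensorProduct.add_tmul, ha, hb]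
    | add p q hp hq => simp only [map_add, hp, hq]
  refine (h1 (Δ h)).trans ?_
  rw [← Coalgebra.coassoc_apply, h2, ← LinearMap.comp_apply (LinearMap.rTensor _ _),
    ← LinearMap.rTensor_comp]
  rfl

theorem hitLeft_sum {ι : Type*} (s : Finset ι) (θ : ι → H →ₗ[k] k) :
    hitLeft (∑ i ∈ s, θ i) = ∑ i ∈ s, hitLeft (θ i) := by
  have h : ∀ (z : H ⊗[k] H), (∑ i ∈ s, θ i).rTensor H z = ∑ i ∈ s, (θ i).rTensor H z := by
    intro z
    induction z with
    | zero => simp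
    | tmul p q => simp [TensorProduct.sum_tmul]
    | add p q hp hq => simp only [map_add, Finset.sum_add_distrib, hp, hq]
  ext x
  simp [hitLeft, h]

variable [WeakHopfAlgebra k H]

variable (k H) in
/-- `ε_t(1₁) ⊗ 1₂ = S(1₁) ⊗ 1₂`. -/
theorem rTensor_targetMap_comul_one : (εt).rTensor H (Δ 1) = (𝒮).rTensor H (Δ 1) := by
  have h1 : (εs).rTensor H (Δ 1) = Δ 1 :=
    (rTensor_sourceMap_comul 1).trans (one_mul (Δ 1))
  have h2 : εt ∘ₗ εs = 𝒮 ∘ₗ εs := LinearMap.ext fun h => targetMap_sourceMap (k := k) h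
  calc (εt).rTensor H (Δ 1) = (εt).rTensor H ((εs).rTensor H (Δ 1)) := by rw [h1]
    _ = (𝒮).rTensor H ((εs).rTensor H (Δ 1)) := by
      rw [← LinearMap.rTensor_comp_apply, h2, LinearMap.rTensor_comp_apply]
    _ = (𝒮).rTensor H (Δ 1) := by rw [h1]

/-- `S²(w₂)₁S(w₁) ⊗ S²(w₂)₂ = 1₁ ⊗ 1₂S²(w)`. -/
theorem sum_comul_antipode_antipode_mul {ι : Type*} {w : H} (r : Coalgebra.Repr k w ι) :
    ∑ i ∈ r.index, Δ (𝒮 (𝒮 (r.right i))) * (𝒮 (r.left i) ⊗ₜ[k] (1 : H)) =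
      Δ 1 * ((1 : H) ⊗ₜ[k] 𝒮 (𝒮 w)) := by
  -- `Q` is the antimultiplicative flip of `S ⊗ S`, with `Q(Δ(h)) = Δ(S(h))`. The claim is `Q`
  -- applied to `(1 ⊗ w₁)Δ(S(w₂)) = S(w₂) ⊗ ε_t(w₁)`.
  let Q : H ⊗[k] H →ₗ[k] H ⊗[k] H :=
    (TensorProduct.comm k H H).toLinearMap ∘ₗ TensorProduct.map 𝒮 𝒮
  have hQmul : ∀ (a : H) (z : H ⊗[k] H), Q ((1 ⊗ₜ[k] a) * z) = Q z * (𝒮 a ⊗ₜ[k] 1) := by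
    intro a z
    induction z with
    | zero => simp
    | tmul p q => simp [Q, antipode_mul]
    | add p q hp hq => simp only [map_add, mul_add, add_mul, hp, hq]
  have hQcomm : ∀ z : H ⊗[k] H, Q (TensorProduct.comm k H H z) = TensorProduct.map 𝒮 𝒮 z := by
    intro z
    induction z with
    | zero => simp
    | tmul p q => simp [Q]
    | add p q hp hq => simp only [map_add, hp, hq]
  have hS : ∀ z : H ⊗[k] H, TensorProduct.map 𝒮 (𝒮 ∘ₗ 𝒮) (z * (1 ⊗ₜ[k] w)) =
      TensorProduct.map 𝒮 (𝒮 ∘ₗ 𝒮) z * (1 ⊗ₜ[k] 𝒮 (𝒮 w)) := by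
    intro z
    induction z with
    | zero => simp
    | tmul p q => simp [antipode_mul]
    | add p q hp hq => simp only [map_add, add_mul, hp, hq]
  have hmap : ∀ (f : H →ₗ[k] H) (z : H ⊗[k] H), TensorProduct.map 𝒮 𝒮 (TensorProduct.map f 𝒮 z) =
      TensorProduct.map 𝒮 (𝒮 ∘ₗ 𝒮) (f.rTensor H z) := by
    intro f z
    induction z with
    | zero => simp
    | tmul p q => simp
    | add p q hp hq => simp only [map_add, hp, hq]
  have hconv : convInr (toConv LinearMap.id) * toConv (Δ ∘ₗ 𝒮) =
      convInr (toConv εt) * convInl (toConv 𝒮) := by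
    rw [toConv_comul_comp_antipode, ← mul_assoc, ← convInr_mul, toConv_id_mul_antipode]
  have hw := congrArg (fun f => f.ofConv w) hconv
  simp only [r.convMul_apply (convInr (toConv LinearMap.id))] at hw
  rw [convInr_mul_convInl_apply] at hw
  have hQS : ∀ h : H, Q (Δ (𝒮 h)) = Δ (𝒮 (𝒮 h)) := fun h => (comul_antipode (𝒮 h)).symm
  calc ∑ i ∈ r.index, Δ (𝒮 (𝒮 (r.right i))) * (𝒮 (r.left i) ⊗ₜ[k] (1 : H))
      = Q (∑ i ∈ r.index, (1 ⊗ₜ[k] r.left i) * Δ (𝒮 (r.right i))) := by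
        simp only [map_sum, hQmul, hQS]
    _ = TensorProduct.map 𝒮 𝒮 (TensorProduct.map εt 𝒮 (Δ w)) := by
        rw [← hQcomm]
        exact congrArg Q hw
    _ = TensorProduct.map 𝒮 (𝒮 ∘ₗ 𝒮) ((εt).rTensor H (Δ w)) :=
        hmap _ _
    _ = TensorProduct.map 𝒮 𝒮 (TensorProduct.map 𝒮 𝒮 (Δ 1)) * (1 ⊗ₜ[k] 𝒮 (𝒮 w)) := by
        rw [rTensor_targetMap_comul, hS, rTensor_targetMap_comul_one, hmap]
    _ = Δ 1 * (1 ⊗ₜ[k] 𝒮 (𝒮 w)) := by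
        rw [map_antipode_antipode_comul_one, TensorProduct.map_comm,
          map_antipode_antipode_comul_one]
        congr 1
        exact (TensorProduct.comm k H H).symm_apply_apply _

/-- The functional `x ↦ tr(w ↦ (xS²(w))₁φ((xS²(w))₂))`. -/
def traceIntegral (φ : H →ₗ[k] k) : H →ₗ[k] k :=
  LinearMap.trace k H ∘ₗ LinearMap.llcomp k H H H (hitRight φ) ∘ₗ
    LinearMap.lcomp k H (𝒮 ∘ₗ 𝒮) ∘ₗ LinearMap.mul k H

theorem traceIntegral_apply (φ : H →ₗ[k] k) (x : H) : traceIntegral φ x =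
    LinearMap.trace k H (hitRight φ ∘ₗ LinearMap.mulLeft k x ∘ₗ 𝒮 ∘ₗ 𝒮) := rfl

/-! ### Trace integrals -/

variable [FiniteDimensional k H]

/-- Since `xS(bᵢ)S²(w) = xS(S(w)bᵢ)`, cyclicity moves `w ↦ S(w)bᵢ` to the outside. Summing over the
basis collapses the operators, by `S * id = ε_s`, to `h ↦ ε_s(xS(h))`. This has trace `∑ ε(xS(1₁)1₂)
= ε(x)`. -/
theorem sum_traceIntegral_mul_antipode {ι : Type*} [Fintype ι] (b : Module.Basis ι k H) (x : H) :
    ∑ i, traceIntegral (b.coord i) (x * 𝒮 (b i)) = ε x := by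
  have h1 : ∀ i, traceIntegral (b.coord i) (x * 𝒮 (b i)) =
      LinearMap.trace k H ((LinearMap.mulRight k (b i) ∘ₗ 𝒮) ∘ₗ
        (hitRight (b.coord i) ∘ₗ LinearMap.mulLeft k x ∘ₗ 𝒮)) := by
    intro i
    rw [LinearMap.trace_comp_comm', traceIntegral_apply]
    congr 1
    ext h
    simp [antipode_mul]
  have h2 : ∀ t : H ⊗[k] H, ∑ i, 𝒮 (TensorProduct.rid k H ((b.coord i).lTensor H t)) * b i =
      LinearMap.mul' k H (TensorProduct.map 𝒮 LinearMap.id t) := by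
    intro t
    induction t with
    | zero => simp
    | tmul p q =>
      simp only [LinearMap.lTensor_tmul, TensorProduct.rid_tmul, map_smul, smul_mul_assoc,
        Module.Basis.coord_apply, TensorProduct.map_tmul, LinearMap.mul'_apply, LinearMap.id_apply]
      simp_rw [← mul_smul_comm, ← Finset.mul_sum, b.sum_repr]
    | add p q hp hq => simp only [map_add, add_mul, Finset.sum_add_distrib, hp, hq]
  have r := Coalgebra.Repr.arbitrary k (1 : H)
  have h3 : ∑ i, (LinearMap.mulRight k (b i) ∘ₗ 𝒮) ∘ₗ
        (hitRight (b.coord i) ∘ₗ LinearMap.mulLeft k x ∘ₗ 𝒮) =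
      ∑ j ∈ r.index, (ε ∘ₗ LinearMap.mulRight k (r.right j) ∘ₗ LinearMap.mulLeft k x ∘ₗ
        𝒮).smulRight (r.left j) := by
    ext h
    have := (h2 (Δ (x * 𝒮 h))).trans (mul'_map_antipode_id_comul _)
    rw [sourceMap_apply_eq_sum r] at this
    simpa [hitRight, LinearMap.sum_apply] using this
  have h4 : ∑ j ∈ r.index, 𝒮 (r.left j) * r.right j = 1 := by
    have := mul'_map_antipode_id_comul (k := k) (1 : H)
    rw [sourceMap_one, ← r.eq] at this
    simpa using this
  simp only [h1]
  rw [← map_sum, h3, map_sum]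
  simp only [LinearMap.trace_smulRight, LinearMap.comp_apply, LinearMap.mulLeft_apply,
    LinearMap.mulRight_apply, mul_assoc]
  rw [← map_sum, ← Finset.mul_sum, h4, mul_one]

/-- `x₁T(x₂) = ε_t(x₁T(x₂))` for `T = traceIntegral φ`. -/
theorem targetMap_hitRight_traceIntegral (φ : H →ₗ[k] k) (x : H) :
    εt (hitRight (traceIntegral φ) x) = hitRight (traceIntegral φ) x := by
  -- `op θ (Δ x)` is `w ↦ θ(x₁)x₂S²(w)`, so testing the claim against `θ` compares traces. With `Dᵢ
  -- = hitLeft (bⁱ ∘ S)` and suitable `Gᵢ`, one operator is `∑ DᵢGᵢ` and the other `∑ GᵢDᵢ`.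
  let op (θ : H →ₗ[k] k) (z : H ⊗[k] H) : H →ₗ[k] H :=
    (TensorProduct.lid k H).toLinearMap ∘ₗ θ.rTensor H ∘ₗ LinearMap.mulLeft k z ∘ₗ
      TensorProduct.mk k H H 1 ∘ₗ 𝒮 ∘ₗ 𝒮
  have op_add : ∀ θ z z', op θ (z + z') = op θ z + op θ z' := by
    intro θ z z'
    ext w
    simp [op, add_mul]
  have h1 : ∀ (θ : H →ₗ[k] k) (z : H ⊗[k] H), θ (TensorProduct.rid k H
      ((traceIntegral φ).lTensor H z)) = LinearMap.trace k H (hitRight φ ∘ₗ op θ z) := by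
    intro θ z
    induction z with
    | zero =>
      have : op θ 0 = 0 := by ext w; simp [op]
      simp [this]
    | tmul p q =>
      have : op θ (p ⊗ₜ[k] q) = θ p • (LinearMap.mulLeft k q ∘ₗ 𝒮 ∘ₗ 𝒮) := by
        ext w
        simp [op]
      rw [this]
      simp [traceIntegral_apply, mul_comm, LinearMap.comp_smul]
    | add p q hp hq => rw [op_add, LinearMap.comp_add]; simp only [map_add, hp, hq]
  have b := Module.finBasis k H
  have htgt : ∀ θ : H →ₗ[k] k, op (θ ∘ₗ εt) (Δ x) =
      hitLeft (θ ∘ₗ εt) ∘ₗ LinearMap.mulLeft k x ∘ₗ 𝒮 ∘ₗ 𝒮 := by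
    intro θ
    ext w
    generalize hg : 𝒮 (𝒮 w) = g
    have hmul : ∀ z : H ⊗[k] H, (εt).rTensor H (z * ((1 : H) ⊗ₜ[k] g)) =
        (εt).rTensor H z * ((1 : H) ⊗ₜ[k] g) := by
      intro z
      induction z with
      | zero => simp
      | tmul p q => simp
      | add p q hp hq => simp only [map_add, add_mul, hp, hq]
    have : (εt).rTensor H (Δ x * ((1 : H) ⊗ₜ[k] g)) = (εt).rTensor H (Δ (x * g)) := by
      rw [hmul, rTensor_targetMap_comul, rTensor_targetMap_comul (x * g), mul_assoc,
        Algebra.TensorProduct.tmul_mul_tmul, one_mul]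
    simp only [op, hitLeft, LinearMap.rTensor_comp, LinearMap.comp_apply, LinearMap.mulLeft_apply,
      TensorProduct.mk_apply, hg, this]
  have hDG : ∀ θ : H →ₗ[k] k, hitRight φ ∘ₗ hitLeft (θ ∘ₗ εt) ∘ₗ LinearMap.mulLeft k x ∘ₗ 𝒮 ∘ₗ 𝒮 =
      ∑ i, hitLeft (b.coord i ∘ₗ 𝒮) ∘ₗ (hitRight φ ∘ₗ hitLeft (θ ∘ₗ LinearMap.mulRight k (b i)) ∘ₗ
        LinearMap.mulLeft k x ∘ₗ 𝒮 ∘ₗ 𝒮) := by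
    intro θ
    -- This is `ε_t = id * S`, with `S(h₂)` expanded in the basis.
    have hsum : θ ∘ₗ εt = ∑ i, (toConv (θ ∘ₗ LinearMap.mulRight k (b i)) *
        toConv (b.coord i ∘ₗ 𝒮)).ofConv := by
      ext z
      have : ∀ t : H ⊗[k] H, ∑ i, LinearMap.mul' k k (TensorProduct.map
          (θ ∘ₗ LinearMap.mulRight k (b i)) (b.coord i ∘ₗ 𝒮) t) =
          θ (LinearMap.mul' k H (TensorProduct.map LinearMap.id 𝒮 t)) := by
        intro t
        induction t with
        | zero => simp
        | tmul p q =>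
          simp only [TensorProduct.map_tmul, LinearMap.mul'_apply, LinearMap.id_apply,
            LinearMap.comp_apply, LinearMap.mulRight_apply, Module.Basis.coord_apply]
          simp_rw [mul_comm (θ _), ← smul_eq_mul (α := k), ← map_smul, ← mul_smul_comm, ← map_sum,
            ← Finset.mul_sum, b.sum_repr]
        | add p q hp hq => simp only [map_add, Finset.sum_add_distrib, hp, hq]
      rw [LinearMap.comp_apply, ← mul'_map_id_antipode_comul, ← this, LinearMap.sum_apply]
      rfl
    rw [hsum, hitLeft_sum]
    ext w
    simp [LinearMap.sum_apply, ← hitRight_hitLeft, hitLeft_hitLeft]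
  have hGD : ∀ θ : H →ₗ[k] k, hitRight φ ∘ₗ op θ (Δ x) =
      ∑ i, (hitRight φ ∘ₗ hitLeft (θ ∘ₗ LinearMap.mulRight k (b i)) ∘ₗ
        LinearMap.mulLeft k x ∘ₗ 𝒮 ∘ₗ 𝒮) ∘ₗ hitLeft (b.coord i ∘ₗ 𝒮) := by
    intro θ
    ext w
    have r := Coalgebra.Repr.arbitrary k w
    have hD : ∀ i, hitLeft (b.coord i ∘ₗ 𝒮) w =
        ∑ j ∈ r.index, b.repr (𝒮 (r.left j)) i • r.right j := by
      intro i
      simp [hitLeft, ← r.eq]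
    have hM : ∀ a z : H, hitLeft (θ ∘ₗ LinearMap.mulRight k a) z =
        TensorProduct.lid k H (θ.rTensor H (Δ z * (a ⊗ₜ[k] 1))) := by
      intro a z
      simp only [hitLeft, LinearMap.comp_apply]
      generalize Δ z = t
      induction t with
      | zero => simp
      | tmul p q => simp
      | add p q hp hq => simp only [map_add, add_mul, hp, hq]
    have hop : op θ (Δ x) w = ∑ i, hitLeft (θ ∘ₗ LinearMap.mulRight k (b i))
        (x * 𝒮 (𝒮 (hitLeft (b.coord i ∘ₗ 𝒮) w))) := by
      -- Insert `Δ(1)` after `Δ(x)` and rewrite `Δ(1)(1 ⊗ S²(w))` by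
      -- `sum_comul_antipode_antipode_mul`.
      have hΔ : Δ x * ((1 : H) ⊗ₜ[k] 𝒮 (𝒮 w)) = ∑ j ∈ r.index,
          Δ (x * 𝒮 (𝒮 (r.right j))) * (𝒮 (r.left j) ⊗ₜ[k] (1 : H)) := by
        rw [← comul_mul_comul_one, mul_assoc, ← sum_comul_antipode_antipode_mul r,
          Finset.mul_sum]
        simp only [← mul_assoc, ← WeakBialgebra.comul_mul]
      simp only [op, LinearMap.comp_apply, LinearMap.mulLeft_apply, TensorProduct.mk_apply, hΔ,
        map_sum, hD, Finset.mul_sum, Finset.sum_mul, map_smul, mul_smul_comm, smul_mul_assoc, hM,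
        LinearEquiv.coe_coe]
      rw [Finset.sum_comm]
      refine Finset.sum_congr rfl fun j _ => ?_
      simp_rw [← map_smul, ← map_sum, ← mul_smul_comm, ← Finset.mul_sum, TensorProduct.smul_tmul',
        ← TensorProduct.sum_tmul, b.sum_repr]
    simp [hop, LinearMap.sum_apply]
  refine sub_eq_zero.1 ((Module.forall_dual_apply_eq_zero_iff k _).1 fun θ => ?_)
  rw [map_sub, sub_eq_zero]
  refine (h1 (θ ∘ₗ εt) (Δ x)).trans (Eq.trans ?_ (h1 θ (Δ x)).symm)
  rw [htgt, hDG, hGD, map_sum, map_sum]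
  exact Finset.sum_congr rfl fun i _ => LinearMap.trace_comp_comm' _ _

end Integral

/-! ### Weak Galois extensions are finitely generated projective -/

theorem projective_and_finite_of_dualBasis {R M ι : Type*} [Ring R] [AddCommGroup M] [Module R M]
    [Fintype ι] (φ : ι → M →ₗ[R] R) (y : ι → M) (h : ∀ m, ∑ i, φ i m • y i = m) :
    Module.Projective R M ∧ Module.Finite R M := by
  classical
  have hcomp : Fintype.linearCombination R y ∘ₗ LinearMap.pi φ = LinearMap.id :=
    LinearMap.ext fun m => by simpa [Fintype.linearCombination_apply] using h m
  refine ⟨Module.Projective.of_split _ _ hcomp, Module.Finite.of_surjective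
    (Fintype.linearCombination R y) fun m => ⟨LinearMap.pi φ m, LinearMap.congr_fun hcomp m⟩⟩

namespace WeakComoduleAlgebra

variable {k : Type u} {H : Type v} {A : Type w} [Field k] [Ring H] [Algebra k H] [Coalgebra k H]
  [Ring A] [Algebra k A] (ρ : WeakComoduleAlgebra k H A)

local notation "Δ" => Coalgebra.comul (R := k) (A := H)
local notation "ε" => Coalgebra.counit (R := k) (A := H)
local notation "𝒮" => WeakHopfAlgebra.antipode (k := k) (H := H)
local notation "εt" => targetMap k H

theorem coact_one_mul_coact (a : A) : ρ.coact 1 * ρ.coact a = ρ.coact a := by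
  rw [← ρ.coact_mul, one_mul]

theorem coact_mul_coact_one (a : A) : ρ.coact a * ρ.coact 1 = ρ.coact a := by
  rw [← ρ.coact_mul, mul_one]

theorem rTensor_coact_coact (a : A) : ρ.coact.rTensor H (ρ.coact a) =
    (TensorProduct.assoc k A H H).symm ((Δ).lTensor A (ρ.coact a)) := by
  rw [← ρ.coassoc, LinearEquiv.symm_apply_apply]

/-- `a₀ ⊗ ε_t(a₁) = 1₀a ⊗ 1₁`. -/
theorem lTensor_targetMap_coact [WeakBialgebra k H] (a : A) :
    (εt).lTensor A (ρ.coact a) = ρ.coact 1 * (a ⊗ₜ[k] (1 : H)) := by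
  refine lTensor_targetMap_of_multiplicative ρ.coact ρ.coact_mul ρ.counit_coact ?_ a
  obtain ⟨t, ht⟩ := ρ.coact_one_mem
  rw [rTensor_coact_coact, ← ht]
  clear ht
  have aux : ∀ (a : A) (h : H) (w : H ⊗[k] H),
      (TensorProduct.assoc k A H H).symm (a ⊗ₜ[k] (w * (h ⊗ₜ[k] (1 : H)))) =
      (TensorProduct.assoc k A H H).symm ((1 : A) ⊗ₜ[k] w) * ((a ⊗ₜ[k] h) ⊗ₜ[k] (1 : H)) := by
    intro a h w
    induction w with
    | zero => simp
    | tmul p q => simp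
    | add p q hp hq => simp only [map_add, TensorProduct.tmul_add, add_mul, hp, hq]
  induction t with
  | zero => simp
  | tmul u x =>
    simp only [LinearMap.lTensor_tmul, Submodule.subtype_apply]
    rw [comul_of_mem_targetSpace' x.2, aux]
  | add p q hp hq => simp only [map_add, TensorProduct.add_tmul, mul_add, hp, hq]

/-- The map `a ↦ a₀T(a₁)`. -/
def coactTrace (T : H →ₗ[k] k) : A →ₗ[k] A :=
  (TensorProduct.rid k A).toLinearMap ∘ₗ T.lTensor A ∘ₗ ρ.coact

theorem coact_coactTrace (T : H →ₗ[k] k) (a : A) :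
    ρ.coact (ρ.coactTrace T a) = (hitRight T).lTensor A (ρ.coact a) := by
  have h1 : ∀ z : A ⊗[k] H, ρ.coact (TensorProduct.rid k A (T.lTensor A z)) =
      TensorProduct.rid k (A ⊗[k] H) (T.lTensor (A ⊗[k] H) (ρ.coact.rTensor H z)) := by
    intro z
    induction z with
    | zero => simp
    | tmul p q => simp
    | add p q hp hq => simp only [map_add, hp, hq]
  have h2 : ∀ (a : A) (w : H ⊗[k] H), TensorProduct.rid k (A ⊗[k] H) (T.lTensor (A ⊗[k] H)
      ((TensorProduct.assoc k A H H).symm (a ⊗ₜ[k] w))) =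
      a ⊗ₜ[k] TensorProduct.rid k H (T.lTensor H w) := by
    intro a w
    induction w with
    | zero => simp
    | tmul p q => simp
    | add p q hp hq => simp only [map_add, TensorProduct.tmul_add, hp, hq]
  have h3 : ∀ z : A ⊗[k] H, TensorProduct.rid k (A ⊗[k] H) (T.lTensor (A ⊗[k] H)
      ((TensorProduct.assoc k A H H).symm ((Δ).lTensor A z))) = (hitRight T).lTensor A z := by
    intro z
    induction z with
    | zero => simp
    | tmul p q => rw [LinearMap.lTensor_tmul, h2]; rfl
    | add p q hp hq => simp only [map_add, hp, hq]
  refine (h1 _).trans ?_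
  rw [rTensor_coact_coact, h3]

/-- For `c = a₀T(a₁)`, coassociativity gives `ρ(c) = a₀ ⊗ a₁T(a₂)`, whose second leg is fixed by
`ε_t`. But `id ⊗ ε_t` sends `ρ(c)` to `1₀c ⊗ 1₁`. -/
theorem coactTrace_mem_coinvariants [WeakBialgebra k H] {T : H →ₗ[k] k}
    (hT : ∀ x, εt (hitRight T x) = hitRight T x) (a : A) :
    ρ.coactTrace T a ∈ ρ.coinvariants := by
  have hT' : εt ∘ₗ hitRight T = hitRight T := LinearMap.ext hT
  change ρ.coact _ = ρ.coact 1 * _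
  rw [← lTensor_targetMap_coact, coact_coactTrace, ← LinearMap.lTensor_comp_apply, hT']

theorem coactTrace_coinvariants_mul [WeakBialgebra k H] (T : H →ₗ[k] k) (b : ρ.coinvariants)
    (a : A) : ρ.coactTrace T ((b : A) * a) = b * ρ.coactTrace T a := by
  have hb : ρ.coact ((b : A) * a) = (b : A) • ρ.coact a := by
    rw [ρ.coact_mul, ρ.coact_of_mem_coinvariants b.2, smul_mul_assoc, coact_one_mul_coact]
  simp only [coactTrace, LinearMap.comp_apply, hb]
  generalize ρ.coact a = z
  induction z with
  | zero => simp
  | tmul p q => simp [TensorProduct.smul_tmul']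
  | add p q hp hq => simp only [map_add, smul_add, mul_add, hp, hq]

/-! ### The dual basis of a weak Galois extension -/

variable [WeakHopfAlgebra k H]

/-- The map `a ⊗ h ↦ a₀ ⊗ a₁S(h)`. -/
def coactAntipode : A ⊗[k] H →ₗ[k] A ⊗[k] H :=
  LinearMap.mul' k (A ⊗[k] H) ∘ₗ TensorProduct.map ρ.coact (TensorProduct.mk k A H 1 ∘ₗ 𝒮)

theorem coactAntipode_tmul (a : A) (h : H) :
    ρ.coactAntipode (a ⊗ₜ[k] h) = ρ.coact a * (1 ⊗ₜ[k] 𝒮 h) := rfl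

theorem coactAntipode_smul (a : A) (z : A ⊗[k] H) :
    ρ.coactAntipode (a • z) = ρ.coact a * ρ.coactAntipode z := by
  induction z with
  | zero => simp
  | tmul p q =>
    rw [TensorProduct.smul_tmul', coactAntipode_tmul, coactAntipode_tmul, smul_eq_mul,
      ρ.coact_mul, mul_assoc]
  | add p q hp hq => simp only [map_add, smul_add, mul_add, hp, hq]

theorem coactAntipode_one_tmul_mul (g : H) (z : A ⊗[k] H) :
    ρ.coactAntipode ((1 ⊗ₜ[k] g) * z) = ρ.coactAntipode z * (1 ⊗ₜ[k] 𝒮 g) := by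
  induction z with
  | zero => simp
  | tmul p q =>
    rw [Algebra.TensorProduct.tmul_mul_tmul, coactAntipode_tmul, coactAntipode_tmul, one_mul,
      antipode_mul, mul_assoc, Algebra.TensorProduct.tmul_mul_tmul, one_mul]
  | add p q hp hq => simp only [map_add, add_mul, mul_add, hp, hq]

/-- `a₀ ⊗ a₁S(a₂) = 1₀a ⊗ 1₁`. -/
theorem coactAntipode_coact (a : A) :
    ρ.coactAntipode (ρ.coact a) = ρ.coact 1 * (a ⊗ₜ[k] 1) := by
  let G : (A ⊗[k] H) ⊗[k] H →ₗ[k] A ⊗[k] H := LinearMap.mul' k (A ⊗[k] H) ∘ₗ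
    TensorProduct.map LinearMap.id (TensorProduct.mk k A H 1 ∘ₗ 𝒮)
  have h1 : ∀ z : A ⊗[k] H, ρ.coactAntipode z = G (ρ.coact.rTensor H z) := by
    intro z
    induction z with
    | zero => simp
    | tmul p q => rfl
    | add p q hp hq => simp only [map_add, hp, hq]
  have h2 : ∀ (a : A) (w : H ⊗[k] H), G ((TensorProduct.assoc k A H H).symm (a ⊗ₜ[k] w)) =
      a ⊗ₜ[k] LinearMap.mul' k H (TensorProduct.map LinearMap.id 𝒮 w) := by
    intro a w
    induction w with
    | zero => simp
    | tmul p q => simp [G]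
    | add p q hp hq => simp only [map_add, TensorProduct.tmul_add, hp, hq]
  have h3 : ∀ z : A ⊗[k] H, G ((TensorProduct.assoc k A H H).symm ((Δ).lTensor A z)) =
      (εt).lTensor A z := by
    intro z
    induction z with
    | zero => simp
    | tmul p q =>
      rw [LinearMap.lTensor_tmul, h2, mul'_map_id_antipode_comul, LinearMap.lTensor_tmul]
    | add p q hp hq => simp only [map_add, hp, hq]
  rw [h1, rTensor_coact_coact, h3, lTensor_targetMap_coact]

/-- The antipode cancels the coaction on `y`, so a known image under the Galois map determines `∑
ρ(xᵢ)(yᵢ ⊗ 1)`. -/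
theorem coactAntipode_preGalois (x y : A) :
    ρ.coactAntipode (ρ.preGalois (x ⊗ₜ[ℤ] y)) = ρ.coact x * (y ⊗ₜ[k] 1) := by
  rw [preGalois_tmul, coactAntipode_smul, coactAntipode_coact, ← mul_assoc, coact_mul_coact_one]

/-- If `∑ xᵢ(yᵢ)₀ ⊗ (yᵢ)₁ = 1₀ ⊗ g1₁`, then `∑ (axᵢ)₀T((axᵢ)₁)yᵢ = a₀T(a₁S(g))`. -/
theorem sum_coactTrace_mul (T : H →ₗ[k] k) (g : H) (s : Finset (A × A))
    (hs : ρ.preGalois (∑ p ∈ s, p.1 ⊗ₜ[ℤ] p.2) = (1 ⊗ₜ[k] g) * ρ.coact 1) (a : A) :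
    ∑ p ∈ s, ρ.coactTrace T (a * p.1) * p.2 =
      ρ.coactTrace (T ∘ₗ LinearMap.mulRight k (𝒮 g)) a := by
  have h1 : ∑ p ∈ s, ρ.coact (a * p.1) * (p.2 ⊗ₜ[k] (1 : H)) =
      ρ.coact a * ((1 : A) ⊗ₜ[k] 𝒮 g) := by
    have := congrArg (fun z => ρ.coact a * ρ.coactAntipode z) hs
    simp only [map_sum, coactAntipode_preGalois, coactAntipode_one_tmul_mul, coactAntipode_coact,
      Finset.mul_sum, ← mul_assoc, ← ρ.coact_mul, mul_one] at this
    rw [this, mul_assoc _ ((1 : A) ⊗ₜ[k] (1 : H)), Algebra.TensorProduct.tmul_mul_tmul, one_mul,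
      one_mul]
  have h2 : ∀ (y : A) (z : A ⊗[k] H), TensorProduct.rid k A (T.lTensor A (z * (y ⊗ₜ[k] 1))) =
      TensorProduct.rid k A (T.lTensor A z) * y := by
    intro y z
    induction z with
    | zero => simp
    | tmul p q => simp
    | add p q hp hq => simp only [map_add, add_mul, hp, hq]
  have h3 : ∀ z : A ⊗[k] H, TensorProduct.rid k A (T.lTensor A (z * (1 ⊗ₜ[k] 𝒮 g))) =
      TensorProduct.rid k A ((T ∘ₗ LinearMap.mulRight k (𝒮 g)).lTensor A z) := by
    intro z
    induction z with
    | zero => simp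
    | tmul p q => simp
    | add p q hp hq => simp only [map_add, add_mul, hp, hq]
  have h4 := congrArg (fun z => TensorProduct.rid k A (T.lTensor A z)) h1
  simp only [map_sum, h2, h3] at h4
  exact h4

theorem IsWeakGalois.exists_preGalois_eq {ρ : WeakComoduleAlgebra k H A} (h : ρ.IsWeakGalois)
    (g : H) : ∃ s : Finset (A × A),
      ρ.preGalois (∑ p ∈ s, p.1 ⊗ₜ[ℤ] p.2) = (1 ⊗ₜ[k] g) * ρ.coact 1 := by
  obtain ⟨q, hq⟩ := h.2 ⟨(1 ⊗ₜ[k] g) * ρ.coact 1, _, rfl⟩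
  obtain ⟨t, rfl⟩ := Submodule.Quotient.mk_surjective _ q
  obtain ⟨s, rfl⟩ := TensorProduct.exists_finset t
  exact ⟨s, congrArg Subtype.val hq⟩

/-- The dual basis is indexed by pairs of a basis vector `bᵢ` and a term `x ⊗ y` of a chosen lift of
`(1 ⊗ bᵢ)ρ(1)`. The functional is `a ↦ (ax)₀Tᵢ((ax)₁)`, with vector `y`. -/
theorem IsWeakGalois.projective_and_finite [FiniteDimensional k H]
    {ρ : WeakComoduleAlgebra k H A} (h : ρ.IsWeakGalois) :
    Module.Projective ρ.coinvariants A ∧ Module.Finite ρ.coinvariants A := by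
  choose s hs using h.exists_preGalois_eq
  have b := Module.finBasis k H
  let f (φ : H →ₗ[k] k) : A →ₗ[ρ.coinvariants] ρ.coinvariants :=
    { toFun := fun a => ⟨ρ.coactTrace (traceIntegral φ) a,
        ρ.coactTrace_mem_coinvariants (targetMap_hitRight_traceIntegral φ) a⟩
      map_add' := fun x y => Subtype.ext (map_add _ x y)
      map_smul' := fun c x => Subtype.ext (ρ.coactTrace_coinvariants_mul _ c x) }
  let R (x : A) : A →ₗ[ρ.coinvariants] A :=
    { toFun := fun a => a * x
      map_add' := fun _ _ => add_mul _ _ x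
      map_smul' := fun c a => smul_mul_assoc c a x }
  refine projective_and_finite_of_dualBasis
    (ι := Σ i : Fin (Module.finrank k H), {p // p ∈ s (b i)})
    (fun j => f (b.coord j.1) ∘ₗ R j.2.1.1) (fun j => j.2.1.2) fun a => ?_
  have hε : ∑ i, ρ.coactTrace (traceIntegral (b.coord i) ∘ₗ LinearMap.mulRight k (𝒮 (b i))) a =
      a := by
    have h1 : ∀ z : A ⊗[k] H, ∑ i, TensorProduct.rid k A ((traceIntegral (b.coord i) ∘ₗ
        LinearMap.mulRight k (𝒮 (b i))).lTensor A z) =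
        TensorProduct.rid k A ((ε).lTensor A z) := by
      intro z
      induction z with
      | zero => simp
      | tmul p q => simp [← Finset.sum_smul, sum_traceIntegral_mul_antipode b q]
      | add p q hp hq => simp only [map_add, Finset.sum_add_distrib, hp, hq]
    exact (h1 (ρ.coact a)).trans (ρ.counit_coact a)
  rw [Fintype.sum_sigma]
  refine Eq.trans (Finset.sum_congr rfl fun i _ => ?_) hε
  rw [← ρ.sum_coactTrace_mul _ _ _ (hs (b i)) a, ← Finset.sum_coe_sort (s (b i))]
  rfl

end WeakComoduleAlgebra

end

theorem theorem2p3 {k : Type u} {H : Type v} {A : Type w} [Field k]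
    [Ring H] [Algebra k H] [Coalgebra k H] [WeakHopfAlgebra k H] [FiniteDimensional k H]
    [Ring A] [Algebra k A] (ρ : WeakComoduleAlgebra k H A)
    (hGalois : ρ.IsWeakGalois)
    (hflat : IsRightFaithfullyFlat ρ.coinvariants)
    (hfin : finitisticDimension ρ.coinvariants < ⊤) :
    finitisticDimension ρ.coinvariants ≤ finitisticDimension A := by
  obtain ⟨_, _⟩ := hGalois.projective_and_finite
  exact finitisticDimension_le_of_faithfullyFlat hflat hfin
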